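/- **Setting.** Let $\Theta\subset\mathbb{R}^{d}$ be compact, $\theta^*$ an interior point of $\Theta$, $\mathcal X\subset\mathbb{R}^{d_x}$ compact, $\mathcal Y\subset\mathbb{R}^{d_y}$, $\mathcal W\subset\mathbb{R}^{d_w}$, $s\ge 0$ an integer, $\mu$ a probability measure on $\mathcal X$ and $\nu$ a $\sigma$-finite measure on $\mathcal Y$. For each $\theta\in\Theta$ let $\mathbb P_\theta$ be the law of a strictly stationary process $(X_k,Y_k,W_k)_{k\in\mathbb Z}$ with values in $\mathcal X\times\mathcal Y\times\mathcal W$, ergodic for $\theta=\theta^*$. Write $\overline{\mathbf Y}_k=(Y_k,\dots,Y_{k-s+1})$, $\mathbf U_a^b=(U_a,\dots,U_b)$ and $\overline{\mathbf Y}_a^b=(\overline{\mathbf Y}_a,\dots,\overline{\mathbf Y}_b)$. Assume: 1. $(X_k)_{k\ge0}$ is under $\mathbb P_\theta$ a Markov chain with transition kernel $Q_\theta$; for $r\ge1$ the $r$-step kernel $Q_\theta^r$ has a density $q_\theta^r(x,x')$ with respect to $\mu$ (with $q_\theta=q_\theta^1$); $\sup_{\theta,x,x'}q_\theta(x,x')<\infty$;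 and for some integer $p\ge1$, $0<\inf_{\theta,x,x'}q_\theta^p(x,x')$ and $\sup_{\theta,x,x'}q_\theta^p(x,x')<\infty$. 2. Under each $\mathbb P_\theta$: for $k\ge1$, $X_k$ is conditionally independent of $(\mathbf X_0^{k-2},\overline{\mathbf Y}_0^{k-1},\mathbf W_0^\infty)$ given $X_{k-1}$; for $k\ge1$, $Y_k$ is conditionally independent of $(\mathbf Y_{-s+1}^{k-s-1},\mathbf X_0^{k-1},\mathbf W_0^{k-1},\mathbf W_{k+1}^\infty)$ given $(\overline{\mathbf Y}_{k-1},X_k,W_k)$, with conditional density $g_\theta(\cdot\mid\overline{\mathbf Y}_{k-1},X_k,W_k)$ with respect to $\nu$; and $\mathbf W_1^\infty$ is conditionally independent of $(\overline{\mathbf Y}_0,X_0)$ given $W_0$. 3. For all $y',\overline{\mathbf y},w$: $0<\inf_{\theta}\inf_{x}g_\theta(y'\mid\overline{\mathbf y},x,w)$ and $\sup_{\theta}\sup_{x}g_\theta(y'\mid\overline{\mathbf y},x,w)<\infty$. 4. With $b_+=\sup_\theta\sup_x g_\theta(Y_1\mid\overline{\mathbf Y}_0,x,W_1)$ and $b_-=\inf_\theta\inf_x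 g_\theta(Y_1\mid\overline{\mathbf Y}_0,x,W_1)$, $\mathbb E_{\theta^*}|\log b_+|<\infty$ and $\mathbb E_{\theta^*}|\log b_-|<\infty$. 5. There are constants $\alpha>0$, $C_1,C_2\in(0,\infty)$, $\beta>1$ with $\mathbb P_{\theta^*}(b_+/b_-\ge C_1e^{\alpha r})\le C_2r^{-\beta}$ for all $r>0$. For $k\ge1$, $m\ge0$, $x\in\mathcal X$, $\theta\in\Theta$ let $$p_\theta(\mathbf Y_{-m+1}^{j}\mid\overline{\mathbf Y}_{-m},\mathbf W_{-m}^{j},X_{-m}=x)=\int\prod_{t=-m+1}^{j}q_\theta(x_{t-1},x_t)\,g_\theta(Y_t\mid\overline{\mathbf Y}_{t-1},x_t,W_t)\,\mu^{\otimes(m+j)}(d\mathbf x_{-m+1}^{j}),\qquad x_{-m}=x,$$ $$p_\theta(Y_k\mid\overline{\mathbf Y}_{-m}^{k-1},\mathbf W_{-m}^k,X_{-m}=x)=\frac{p_\theta(\mathbf Y_{-m+1}^{k}\mid\overline{\mathbf Y}_{-m},\mathbf W_{-m}^{k},X_{-m}=x)}{p_\theta(\mathbf Y_{-m+1}^{k-1}\mid\overline{\mathbf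 Y}_{-m},\mathbf W_{-m}^{k-1},X_{-m}=x)},$$ $$\Delta_{k,m,x}(\theta)=\log p_\theta(Y_k\mid\overline{\mathbf Y}_{-m}^{k-1},\mathbf W_{-m}^k,X_{-m}=x),$$ $$\Delta_{k,m}(\theta)=\log\int p_\theta(Y_k\mid\overline{\mathbf Y}_{-m}^{k-1},\mathbf W_{-m}^k,X_{-m}=x)\,\mathbb P_\theta(X_{-m}\in dx\mid\overline{\mathbf Y}_{-m}^{k-1},\mathbf W_{-m}^k),$$ with any version of the regular conditional distribution. **Claim.** There exist constants $\rho\in(0,1)$ and $M<\infty$ and random variables $A_{k,m}$ and $B_k$ ($k\ge1$, $m\ge0$) such that, $\mathbb P_{\theta^*}$-almost surely, for all $k\ge1$ and $m'\ge m\ge0$, (a) $\displaystyle\sup_{x,x'\in\mathcal X}\sup_{\theta\in\Theta}|\Delta_{k,m,x}(\theta)-\Delta_{k,m',x'}(\theta)|\le A_{k,m}\,\rho^{\lfloor(k+m)/(3p)\rfloor}$, (b) $\displaystyle\sup_{x\in\mathcal X}\sup_{\theta\in\Theta}|\Delta_{k,m,x}(\theta)-\Delta_{k,m}(\theta)|\le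 A_{k,m}\,\rho^{\lfloor(k+m)/(3p)\rfloor}$, (c) $\displaystyle\sup_{m\ge0}\sup_{x\in\mathcal X}\sup_{\theta\in\Theta}|\Delta_{k,m,x}(\theta)|+\sup_{m\ge0}\sup_{\theta\in\Theta}|\Delta_{k,m}(\theta)|\le B_k$, where, $\mathbb P_{\theta^*}$-almost surely, $A_{k,m}\ge M$ for at most finitely many pairs $(k,m)$, and $B_k\in L^1(\mathbb P_{\theta^*})$ for every $k$. Consequently there are random functions $\Delta_{k,\infty}$ on $\Theta$ such that, $\mathbb P_{\theta^*}$-almost surely, for every $k\ge1$ and $x\in\mathcal X$, both $\Delta_{k,m,x}(\theta)$ and $\Delta_{k,m}(\theta)$ converge to $\Delta_{k,\infty}(\theta)$ uniformly in $\theta\in\Theta$ as $m\to\infty$; the limit does not depend on $x$. -/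

import Mathlib

open MeasureTheory ProbabilityTheory Filter Topology

namespace RegimeSwitching

noncomputable section

/-! ### Trajectories `ω = (X_k, Y_k, W_k)_{k ∈ ℤ}` and their coordinates -/

/-- Doubly infinite trajectories of `(X_k, Y_k, W_k)`, with the product `σ`-field. -/
abbrev Path (𝒳 𝒴 𝒲 : Type*) := ℤ → 𝒳 × 𝒴 × 𝒲

section Coordinates

variable {𝒳 𝒴 𝒲 : Type*}

/-- The hidden state `X_k`. -/
def X (k : ℤ) (ω : Path 𝒳 𝒴 𝒲) : 𝒳 := (ω k).1

/-- The observation `Y_k`. -/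
def Y (k : ℤ) (ω : Path 𝒳 𝒴 𝒲) : 𝒴 := (ω k).2.1

/-- The covariate `W_k`. -/
def W (k : ℤ) (ω : Path 𝒳 𝒴 𝒲) : 𝒲 := (ω k).2.2

/-- The block of lagged observations `Ȳ_k = (Y_k, Y_{k-1}, …, Y_{k-s+1})`. -/
def Ybar (s : ℕ) (k : ℤ) (ω : Path 𝒳 𝒴 𝒲) : Fin s → 𝒴 := fun i => Y (k - (i : ℤ)) ω

/-- The time shift on trajectories. -/
def shift (ω : Path 𝒳 𝒴 𝒲) : Path 𝒳 𝒴 𝒲 := fun k => ω (k + 1)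

/-- Values of the conditioning variable `(Ȳ_{-m}, …, Ȳ_{k-1}; W_{-m}, …, W_k)`. -/
abbrev Obs (s : ℕ) (𝒴 𝒲 : Type*) (k m : ℕ) :=
  (Fin (m + k) → Fin s → 𝒴) × (Fin (m + k + 1) → 𝒲)

/-- The conditioning variable `(Ȳ_{-m}, …, Ȳ_{k-1}; W_{-m}, …, W_k)`. -/
def obs (s k m : ℕ) (ω : Path 𝒳 𝒴 𝒲) : Obs s 𝒴 𝒲 k m :=
  (fun i => Ybar s (-(m : ℤ) + (i : ℤ)) ω, fun i => W (-(m : ℤ) + (i : ℤ)) ω)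

variable [MeasurableSpace 𝒳] [MeasurableSpace 𝒴] [MeasurableSpace 𝒲]

/-- The `σ`-field generated by `X_k`, `k ∈ I`. -/
abbrev sigmaX (I : Set ℤ) : MeasurableSpace (Path 𝒳 𝒴 𝒲) :=
  ⨆ k ∈ I, MeasurableSpace.comap (X k) inferInstance

/-- The `σ`-field generated by `Y_k`, `k ∈ I`. -/
abbrev sigmaY (I : Set ℤ) : MeasurableSpace (Path 𝒳 𝒴 𝒲) :=
  ⨆ k ∈ I, MeasurableSpace.comap (Y k) inferInstance

/-- The `σ`-field generated by `W_k`, `k ∈ I`. -/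
abbrev sigmaW (I : Set ℤ) : MeasurableSpace (Path 𝒳 𝒴 𝒲) :=
  ⨆ k ∈ I, MeasurableSpace.comap (W k) inferInstance

/-- The `σ`-field generated by `Ȳ_k`, `k ∈ I`. -/
abbrev sigmaYbar (s : ℕ) (I : Set ℤ) : MeasurableSpace (Path 𝒳 𝒴 𝒲) :=
  ⨆ k ∈ I, MeasurableSpace.comap (Ybar s k) inferInstance

end Coordinates

/-- The `σ`-fields `m₁` and `m₂` are conditionally independent given `m'` under `P`:
`P(t₁ ∩ t₂ | m') = P(t₁ | m') P(t₂ | m')` a.s. for all `t₁ ∈ m₁`, `t₂ ∈ m₂`.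
(Mathlib's `CondIndep` is available on standard Borel spaces only; no such restriction here.) -/
def CondIndepGiven {Ω : Type*} (m' m₁ m₂ : MeasurableSpace Ω) {mΩ : MeasurableSpace Ω}
    (P : @Measure Ω mΩ) : Prop :=
  ∀ t₁ t₂ : Set Ω, MeasurableSet[m₁] t₁ → MeasurableSet[m₂] t₂ →
    P[(t₁ ∩ t₂).indicator (fun _ => (1 : ℝ)) | m'] =ᵐ[P]
      fun ω => (P[t₁.indicator (fun _ => (1 : ℝ)) | m']) ω *
        (P[t₂.indicator (fun _ => (1 : ℝ)) | m']) ω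

/-- The `r`-fold composition `Q^r` of a transition kernel. -/
def kernelPow {𝒳 : Type*} [MeasurableSpace 𝒳] (Q : Kernel 𝒳 𝒳) : ℕ → Kernel 𝒳 𝒳
  | 0 => Kernel.id
  | r + 1 => Q ∘ₖ kernelPow Q r

/-! ### The model -/

/-- The ingredients of a Markov regime switching model with parameter set `Θ`, hidden states in
`𝒳`, observations in `𝒴`, covariates in `𝒲`, and `s` lags.  This only collects the objects, with
their measurability; the relations between them are the predicates that follow. -/
structure Model (Θ 𝒳 𝒴 𝒲 : Type*) [MeasurableSpace 𝒳] [MeasurableSpace 𝒴] [MeasurableSpace 𝒲]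
    (s : ℕ) where
  /-- dominating measure on the hidden state space -/
  μ : Measure 𝒳
  /-- dominating measure on the observation space -/
  ν : Measure 𝒴
  /-- one-step transition kernel `Q_θ` of the hidden chain -/
  Q : Θ → Kernel 𝒳 𝒳
  /-- `q r θ x x'` is the `r`-step transition density `q_θ^r(x, x')`; `q 1` is `q_θ` -/
  q : ℕ → Θ → 𝒳 → 𝒳 → ℝ
  /-- `g θ y ȳ x w` is the conditional density `g_θ(y | ȳ, x, w)` -/
  g : Θ → 𝒴 → (Fin s → 𝒴) → 𝒳 → 𝒲 → ℝ
  /-- law `P_θ` of the doubly infinite stationary process `(X_k, Y_k, W_k)_{k ∈ ℤ}` -/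
  P : Θ → Measure (Path 𝒳 𝒴 𝒲)
  isProbabilityMeasure_μ : IsProbabilityMeasure μ
  sigmaFinite_ν : SigmaFinite ν
  isMarkovKernel_Q : ∀ θ, IsMarkovKernel (Q θ)
  isProbabilityMeasure_P : ∀ θ, IsProbabilityMeasure (P θ)
  measurable_q : ∀ r θ, Measurable fun a : 𝒳 × 𝒳 => q r θ a.1 a.2
  measurable_g : ∀ θ, Measurable fun a : 𝒴 × (Fin s → 𝒴) × 𝒳 × 𝒲 =>
    g θ a.1 a.2.1 a.2.2.1 a.2.2.2

namespace Model

attribute [instance] Model.isProbabilityMeasure_μ Model.sigmaFinite_ν Model.isMarkovKernel_Q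
  Model.isProbabilityMeasure_P

variable {Θ 𝒳 𝒴 𝒲 : Type*} [MeasurableSpace 𝒳] [MeasurableSpace 𝒴] [MeasurableSpace 𝒲] {s : ℕ}

/-- The transition kernel `Q_θ` and its powers `Q_θ^r`, `r ≥ 1`, have the (nonnegative) densities
`q_θ`, `q_θ^r` with respect to `μ`; `q_θ` is bounded; and, for the given `p`, the `p`-step density
satisfies `0 < σ_- ≤ q_θ^p ≤ σ_+ < ∞`, uniformly in `θ` and in the two states. -/
structure TransitionDensities (M : Model Θ 𝒳 𝒴 𝒲 s) (p : ℕ) : Prop where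
  nonneg : ∀ r, 1 ≤ r → ∀ θ x x', 0 ≤ M.q r θ x x'
  density : ∀ r, 1 ≤ r → ∀ θ x,
    kernelPow (M.Q θ) r x = M.μ.withDensity fun x' => ENNReal.ofReal (M.q r θ x x')
  bounded : ∃ σ₀ : ℝ, ∀ θ x x', M.q 1 θ x x' ≤ σ₀
  pos_steps : 1 ≤ p
  minorized : ∃ σ : ℝ, 0 < σ ∧ ∀ θ x x', σ ≤ M.q p θ x x'
  majorized : ∃ σ : ℝ, ∀ θ x x', M.q p θ x x' ≤ σ

/-- The emission kernel `(ȳ, x, w) ↦ g_θ(y | ȳ, x, w) ν(dy)`. -/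
def emission (M : Model Θ 𝒳 𝒴 𝒲 s) (θ : Θ) : Kernel ((Fin s → 𝒴) × 𝒳 × 𝒲) 𝒴 :=
  Kernel.withDensity (Kernel.const _ M.ν) fun a y => ENNReal.ofReal (M.g θ y a.1 a.2.1 a.2.2)

/-- The law `P_θ`, for every `θ`, is that of the model: `(X_k)` is a Markov chain with transition
kernel `Q_θ` (the Markov property is part of `condIndep_X`), `Y_k` has conditional density
`g_θ(· | Ȳ_{k-1}, X_k, W_k)`, the stated conditional independences hold, and the process is
strictly stationary. -/
structure IsRegimeSwitching (M : Model Θ 𝒳 𝒴 𝒲 s) : Prop where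
  transition_X : ∀ θ, ∀ k : ℤ, 1 ≤ k → HasCondDistrib (X k) (X (k - 1)) (M.Q θ) (M.P θ)
  condIndep_X : ∀ θ, ∀ k : ℤ, 1 ≤ k →
    CondIndepGiven (sigmaX {k - 1}) (sigmaX {k})
      (sigmaX (Set.Icc 0 (k - 2)) ⊔ sigmaYbar s (Set.Icc 0 (k - 1)) ⊔ sigmaW (Set.Ici 0)) (M.P θ)
  density_Y : ∀ θ, ∀ k : ℤ, 1 ≤ k →
    HasCondDistrib (Y k) (fun ω => (Ybar s (k - 1) ω, X k ω, W k ω)) (M.emission θ) (M.P θ)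
  condIndep_Y : ∀ θ, ∀ k : ℤ, 1 ≤ k →
    CondIndepGiven (sigmaYbar s {k - 1} ⊔ sigmaX {k} ⊔ sigmaW {k}) (sigmaY {k})
      (sigmaY (Set.Icc (-(s : ℤ) + 1) (k - s - 1)) ⊔ sigmaX (Set.Icc 0 (k - 1)) ⊔
        sigmaW (Set.Icc 0 (k - 1)) ⊔ sigmaW (Set.Ici (k + 1))) (M.P θ)
  condIndep_W : ∀ θ,
    CondIndepGiven (sigmaW {0}) (sigmaW (Set.Ici 1)) (sigmaYbar s {0} ⊔ sigmaX {0}) (M.P θ)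
  stationary : ∀ θ, MeasurePreserving shift (M.P θ) (M.P θ)

/-- For each `(y', ȳ, w)`, `0 < inf_θ inf_x g_θ(y' | ȳ, x, w)` and
`sup_θ sup_x g_θ(y' | ȳ, x, w) < ∞`. -/
def EmissionBounds (M : Model Θ 𝒳 𝒴 𝒲 s) : Prop :=
  ∀ (y' : 𝒴) (ybar : Fin s → 𝒴) (w : 𝒲),
    (∃ c : ℝ, 0 < c ∧ ∀ θ x, c ≤ M.g θ y' ybar x w) ∧ (∃ C : ℝ, ∀ θ x, M.g θ y' ybar x w ≤ C)

/-- `b_+(Ȳ_{k-1}^k, W_k) = sup_θ sup_x g_θ(Y_k | Ȳ_{k-1}, x, W_k)`. -/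
def bPlus (M : Model Θ 𝒳 𝒴 𝒲 s) (k : ℤ) (ω : Path 𝒳 𝒴 𝒲) : ℝ :=
  ⨆ a : Θ × 𝒳, M.g a.1 (Y k ω) (Ybar s (k - 1) ω) a.2 (W k ω)

/-- `b_-(Ȳ_{k-1}^k, W_k) = inf_θ inf_x g_θ(Y_k | Ȳ_{k-1}, x, W_k)`. -/
def bMinus (M : Model Θ 𝒳 𝒴 𝒲 s) (k : ℤ) (ω : Path 𝒳 𝒴 𝒲) : ℝ :=
  ⨅ a : Θ × 𝒳, M.g a.1 (Y k ω) (Ybar s (k - 1) ω) a.2 (W k ω)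

/-- `E_{θ*} |log b_+(Ȳ_0^1, W_1)| < ∞` and `E_{θ*} |log b_-(Ȳ_0^1, W_1)| < ∞`. -/
def LogIntegrable (M : Model Θ 𝒳 𝒴 𝒲 s) (θs : Θ) : Prop :=
  Integrable (fun ω => Real.log (M.bPlus 1 ω)) (M.P θs) ∧
    Integrable (fun ω => Real.log (M.bMinus 1 ω)) (M.P θs)

/-- There are `α > 0`, `C₁, C₂ ∈ (0, ∞)` and `β > 1` such that
`P_{θ*}(b_+ / b_- ≥ C₁ e^{α r}) ≤ C₂ r^{-β}` for all `r > 0`. -/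
def RatioTail (M : Model Θ 𝒳 𝒴 𝒲 s) (θs : Θ) : Prop :=
  ∃ α C₁ C₂ β : ℝ, 0 < α ∧ 0 < C₁ ∧ 0 < C₂ ∧ 1 < β ∧ ∀ r : ℝ, 0 < r →
    M.P θs {ω | C₁ * Real.exp (α * r) ≤ M.bPlus 1 ω / M.bMinus 1 ω} ≤
      ENNReal.ofReal (C₂ * r ^ (-β))

/-! ### Conditional densities of the observations -/

/-- The conditional density `p_θ(Y_{a+1}, …, Y_{a+n} | Ȳ_a, W_a, …, W_{a+n}, X_a = x)`, that is
`∫ ∏_{t=a+1}^{a+n} q_θ(x_{t-1}, x_t) g_θ(Y_t | Ȳ_{t-1}, x_t, W_t) μ^{⊗n}(dx_{a+1}, …, dx_{a+n})`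
with `x_a = x`; here `z i` stands for `x_{a+1+i}`. -/
def likelihood (M : Model Θ 𝒳 𝒴 𝒲 s) (θ : Θ) (a : ℤ) (n : ℕ) (x : 𝒳) (ω : Path 𝒳 𝒴 𝒲) : ℝ :=
  ∫ z : Fin n → 𝒳, ∏ i : Fin n,
    M.q 1 θ ((Fin.cons x z : Fin (n + 1) → 𝒳) i.castSucc) (z i) *
      M.g θ (Y (a + 1 + (i : ℤ)) ω) (Ybar s (a + (i : ℤ)) ω) (z i) (W (a + 1 + (i : ℤ)) ω)
    ∂(Measure.pi fun _ => M.μ)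

/-- The conditional density `p_θ(Y_k | Ȳ_{-m}^{k-1}, W_{-m}^k, X_{-m} = x)` for `k ≥ 1`, `m ≥ 0`:
the quotient of the conditional densities of `(Y_{-m+1}, …, Y_k)` and of
`(Y_{-m+1}, …, Y_{k-1})`. -/
def condDensity (M : Model Θ 𝒳 𝒴 𝒲 s) (k m : ℕ) (x : 𝒳) (θ : Θ) (ω : Path 𝒳 𝒴 𝒲) : ℝ :=
  M.likelihood θ (-(m : ℤ)) (m + k) x ω / M.likelihood θ (-(m : ℤ)) (m + k - 1) x ω

/-- `κ θ k m` is a version of the regular conditional distribution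
`P_θ(X_{-m} ∈ · | Ȳ_{-m}^{k-1}, W_{-m}^k)`. -/
def IsInitialLaw (M : Model Θ 𝒳 𝒴 𝒲 s) (κ : Θ → (k m : ℕ) → Kernel (Obs s 𝒴 𝒲 k m) 𝒳) : Prop :=
  ∀ θ k m, IsMarkovKernel (κ θ k m) ∧
    HasCondDistrib (X (-(m : ℤ))) (obs s k m) (κ θ k m) (M.P θ)

/-- `Δ_{k,m,x}(θ) = log p_θ(Y_k | Ȳ_{-m}^{k-1}, W_{-m}^k, X_{-m} = x)`. -/
def DeltaX (M : Model Θ 𝒳 𝒴 𝒲 s) (k m : ℕ) (x : 𝒳) (θ : Θ) (ω : Path 𝒳 𝒴 𝒲) : ℝ :=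
  Real.log (M.condDensity k m x θ ω)

/-- `Δ_{k,m}(θ) = log p_θ(Y_k | Ȳ_{-m}^{k-1}, W_{-m}^k)`, where the density is
`∫ p_θ(Y_k | Ȳ_{-m}^{k-1}, W_{-m}^k, X_{-m} = x) P_θ(X_{-m} ∈ dx | Ȳ_{-m}^{k-1}, W_{-m}^k)`. -/
def Delta (M : Model Θ 𝒳 𝒴 𝒲 s) (κ : Θ → (k m : ℕ) → Kernel (Obs s 𝒴 𝒲 k m) 𝒳)
    (k m : ℕ) (θ : Θ) (ω : Path 𝒳 𝒴 𝒲) : ℝ :=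
  Real.log (∫ x, M.condDensity k m x θ ω ∂(κ θ k m (obs s k m ω)))

end Model

end

end RegimeSwitching

/-! Fix `θ`, a trajectory and a time `k`. Read backwards from time `k - 1`, the numerator `u` and
the denominator `v` of the conditional density of `Y_k` are iterates of the same positive operators
`f ↦ ∫ g f dQ_θ(x, ·)`. Positivity keeps `u / v` in any interval `[l, L]` containing its range. Over
`p` steps, `u - l v` and `L v - u` are both comparable with their `μ`-integrals, by the bounds on
`q_θ^p` and `b_- ≤ g_θ ≤ b_+`. This shrinks the oscillation by `1 - ε`, with `ε` a constant times a
product of `p` ratios `b_- / b_+` (`ratio_mem_Icc_contract`). Overlapping windows of `p` steps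
combine into the bound `exp (p - ∑ ε)` on the `p`-th power of the oscillation
(`pow_le_exp_of_contract`).

The `ε` are a stationary ergodic sequence with values in `(0, 1]`, hence of positive mean. By the
maximal ergodic theorem, used for the shift and for its inverse, their sum over the times from `-m`
to `k - 1` is almost surely at least `c (k + m) - C` (`exists_linear_mixing`). Passing to logarithms
costs a factor `b_+ / b_-` at time `k`, which grows subexponentially by the tail condition and
Borel–Cantelli (`ae_ratio_le_exp`). The surplus in the exponent gives the geometric rate and the
finiteness of the exceptional pairs (`finite_forgettingConst`).

The interval obtained for `m` contains the densities for all `m' ≥ m` and all initial states, and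
therefore their averages. So (a), (b) and the uniform limits come from one estimate. The initial
interval `[b_-, b_+]` at time `k` gives (c). -/

namespace RegimeSwitching

/-! ### Weighted averages under a Markov kernel. -/

section Transfer

variable {𝒳 : Type*} [MeasurableSpace 𝒳]

/-- Nonnegative bounded measurable functions. -/
structure NonnegBdd (f : 𝒳 → ℝ) : Prop where
  measurable : Measurable f
  nonneg : ∀ x, 0 ≤ f x
  bdd : ∃ C, ∀ x, f x ≤ C

theorem NonnegBdd.integrable {f : 𝒳 → ℝ} (hf : NonnegBdd f) (P : Measure 𝒳) [IsFiniteMeasure P] :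
    Integrable f P := by
  obtain ⟨C, hC⟩ := hf.bdd
  refine Integrable.of_bound hf.measurable.aestronglyMeasurable C (ae_of_all _ fun x => ?_)
  rw [Real.norm_eq_abs, abs_of_nonneg (hf.nonneg x)]
  exact hC x

theorem NonnegBdd.mul {f g : 𝒳 → ℝ} (hf : NonnegBdd f) (hg : NonnegBdd g) :
    NonnegBdd fun x => f x * g x := by
  obtain ⟨C, hC⟩ := hf.bdd
  obtain ⟨D, hD⟩ := hg.bdd
  exact ⟨hf.measurable.mul hg.measurable, fun x => mul_nonneg (hf.nonneg x) (hg.nonneg x),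
    C * D, fun x => mul_le_mul (hC x) (hD x) (hg.nonneg x) ((hf.nonneg x).trans (hC x))⟩

/-- The average `x ↦ ∫ g f dQ(x, ·)`. -/
noncomputable def transfer (Q : Kernel 𝒳 𝒳) (g f : 𝒳 → ℝ) (x : 𝒳) : ℝ := ∫ y, g y * f y ∂(Q x)

theorem NonnegBdd.integral_kernel {f : 𝒳 → ℝ} (hf : NonnegBdd f) (Q : Kernel 𝒳 𝒳)
    [IsMarkovKernel Q] : NonnegBdd fun x => ∫ y, f y ∂(Q x) := by
  obtain ⟨C, hC⟩ := hf.bdd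
  refine ⟨?_, fun x => integral_nonneg hf.nonneg, C, fun x => ?_⟩
  · exact (StronglyMeasurable.integral_kernel (κ := Q) hf.measurable.stronglyMeasurable).measurable
  · calc ∫ y, f y ∂(Q x) ≤ ∫ _, C ∂(Q x) :=
          integral_mono (hf.integrable _) (integrable_const _) hC
      _ = C := by simp

theorem NonnegBdd.transfer {f g : 𝒳 → ℝ} (hf : NonnegBdd f) (hg : NonnegBdd g) (Q : Kernel 𝒳 𝒳)
    [IsMarkovKernel Q] : NonnegBdd (transfer Q g f) :=
  (hg.mul hf).integral_kernel Q

instance isMarkovKernel_kernelPow (Q : Kernel 𝒳 𝒳) [IsMarkovKernel Q] (r : ℕ) :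
    IsMarkovKernel (kernelPow Q r) := by
  induction r with
  | zero => unfold kernelPow; infer_instance
  | succ r ih => unfold kernelPow; infer_instance

/-- The definition appends a last step to the chain, whereas the backward recursion prepends a first
one; associativity reconciles the two. -/
theorem kernelPow_succ' (Q : Kernel 𝒳 𝒳) (r : ℕ) :
    kernelPow Q (r + 1) = kernelPow Q r ∘ₖ Q := by
  induction r with
  | zero => simp [kernelPow]
  | succ r ih =>
    calc kernelPow Q (r + 2) = Q ∘ₖ (kernelPow Q r ∘ₖ Q) := by rw [← ih]; rfl
      _ = kernelPow Q (r + 1) ∘ₖ Q := (Kernel.comp_assoc _ _ _).symm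

theorem kernelPow_one (Q : Kernel 𝒳 𝒳) : kernelPow Q 1 = Q := by simp [kernelPow]

/-- Iterated averages against weights between `lo` and `hi` are comparable with `Q^r`. -/
theorem iterate_transfer_bounds (Q : Kernel 𝒳 𝒳) [IsMarkovKernel Q] {G f : ℕ → 𝒳 → ℝ}
    {lo hi : ℕ → ℝ} (hG : ∀ n, NonnegBdd (G n)) (hlo : ∀ n x, lo n ≤ G n x)
    (hlo0 : ∀ n, 0 ≤ lo n) (hhi : ∀ n x, G n x ≤ hi n)
    (hf0 : NonnegBdd (f 0)) (hf : ∀ n, f (n + 1) = transfer Q (G n) (f n)) (r : ℕ) :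
    NonnegBdd (f r) ∧ ∀ x,
      (∏ i ∈ Finset.range r, lo i) * ∫ y, f 0 y ∂(kernelPow Q r x) ≤ f r x ∧
      f r x ≤ (∏ i ∈ Finset.range r, hi i) * ∫ y, f 0 y ∂(kernelPow Q r x) := by
  induction r with
  | zero =>
    refine ⟨hf0, fun x => ?_⟩
    have : ∫ y, f 0 y ∂(kernelPow Q 0 x) = f 0 x := by
      rw [kernelPow, Kernel.id_apply, integral_dirac' _ _ hf0.measurable.stronglyMeasurable]
    simp [this]
  | succ r ih =>
    obtain ⟨hr, hb⟩ := ih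
    have hI := hf0.integral_kernel (kernelPow Q r)
    have hcomp : ∀ x, ∫ y, f 0 y ∂(kernelPow Q (r + 1) x) =
        ∫ y, ∫ z, f 0 z ∂(kernelPow Q r y) ∂(Q x) := by
      intro x
      rw [kernelPow_succ']
      exact Kernel.integral_comp (hf0.integrable _)
    refine ⟨by rw [hf]; exact hr.transfer (hG r) Q, fun x => ?_⟩
    rw [hcomp, hf, transfer, ← integral_const_mul, ← integral_const_mul]
    constructor
    · refine integral_mono ((hI.integrable _).const_mul _) (((hG r).mul hr).integrable _)
        fun y => ?_
      simp only
      rw [Finset.prod_range_succ, mul_right_comm, mul_comm]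
      exact mul_le_mul (hlo r y) (hb y).1
        (mul_nonneg (Finset.prod_nonneg fun i _ => hlo0 i) (hI.nonneg y)) ((hG r).nonneg y)
    · refine integral_mono (((hG r).mul hr).integrable _) ((hI.integrable _).const_mul _)
        fun y => ?_
      simp only
      rw [Finset.prod_range_succ, mul_right_comm, mul_comm _ (hi r)]
      exact mul_le_mul (hhi r y) (hb y).2 (hr.nonneg y) (((hG r).nonneg y).trans (hhi r y))

theorem transfer_lincomb (Q : Kernel 𝒳 𝒳) [IsMarkovKernel Q] {g u v : 𝒳 → ℝ} (hg : NonnegBdd g)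
    (hu : NonnegBdd u) (hv : NonnegBdd v) (a b : ℝ) :
    transfer Q g (fun x => a * u x + b * v x) =
      fun x => a * transfer Q g u x + b * transfer Q g v x := by
  funext x
  simp only [transfer]
  rw [← integral_const_mul, ← integral_const_mul, ← integral_add]
  · congr 1; funext y; ring
  · exact ((hg.mul hu).integrable _).const_mul _
  · exact ((hg.mul hv).integrable _).const_mul _

end Transfer

/-! ### Contraction of the ratio of two iterates. -/

/-- Two sequences of functions obtained by iterating the same weighted averages. -/
structure TransferPair {𝒳 : Type*} [MeasurableSpace 𝒳] (Q : Kernel 𝒳 𝒳) (G : ℕ → 𝒳 → ℝ)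
    (lo hi : ℕ → ℝ) (u v : ℕ → 𝒳 → ℝ) : Prop where
  weight : ∀ n, NonnegBdd (G n)
  lo_le : ∀ n x, lo n ≤ G n x
  lo_pos : ∀ n, 0 < lo n
  le_hi : ∀ n x, G n x ≤ hi n
  u_zero : NonnegBdd (u 0)
  v_zero : ∀ x, v 0 x = 1
  u_succ : ∀ n, u (n + 1) = transfer Q (G n) (u n)
  v_succ : ∀ n, v (n + 1) = transfer Q (G n) (v n)

namespace TransferPair

variable {𝒳 : Type*} [MeasurableSpace 𝒳] {Q : Kernel 𝒳 𝒳} [IsMarkovKernel Q] {G : ℕ → 𝒳 → ℝ}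
  {lo hi : ℕ → ℝ} {u v : ℕ → 𝒳 → ℝ} (h : TransferPair Q G lo hi u v)

include h

theorem nonnegBdd_u (n : ℕ) : NonnegBdd (u n) :=
  (iterate_transfer_bounds Q h.weight h.lo_le (fun n => (h.lo_pos n).le) h.le_hi h.u_zero
    h.u_succ n).1

omit [IsMarkovKernel Q] in
theorem nonnegBdd_v_zero : NonnegBdd (v 0) := by
  rw [funext h.v_zero]
  exact ⟨measurable_const, fun _ => zero_le_one, 1, fun _ => le_rfl⟩

theorem nonnegBdd_v (n : ℕ) : NonnegBdd (v n) :=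
  (iterate_transfer_bounds Q h.weight h.lo_le (fun n => (h.lo_pos n).le) h.le_hi
    h.nonnegBdd_v_zero h.v_succ n).1

theorem v_pos (n : ℕ) (x : 𝒳) : 0 < v n x := by
  have := ((iterate_transfer_bounds Q h.weight h.lo_le (fun n => (h.lo_pos n).le) h.le_hi
    h.nonnegBdd_v_zero h.v_succ n).2 x).1
  refine lt_of_lt_of_le ?_ this
  simp only [h.v_zero, integral_const, probReal_univ, smul_eq_mul, mul_one]
  exact Finset.prod_pos fun i _ => h.lo_pos i

/-- The recursion is linear, so a combination that is nonnegative at stage `n` is itself a sequence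
of weighted averages. It is meant for `u - l v`, `L v - u` and `v`. -/
theorem lincomb_add (a b : ℝ) (n : ℕ) (h0 : ∀ x, 0 ≤ a * u n x + b * v n x) (r : ℕ) :
    NonnegBdd (fun x => a * u (n + r) x + b * v (n + r) x) ∧ ∀ x,
      (∏ i ∈ Finset.range r, lo (n + i)) * ∫ y, (a * u n y + b * v n y) ∂(kernelPow Q r x) ≤
        a * u (n + r) x + b * v (n + r) x ∧
      a * u (n + r) x + b * v (n + r) x ≤
        (∏ i ∈ Finset.range r, hi (n + i)) * ∫ y, (a * u n y + b * v n y) ∂(kernelPow Q r x) := by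
  refine iterate_transfer_bounds Q (G := fun i => G (n + i))
    (f := fun i x => a * u (n + i) x + b * v (n + i) x) (fun i => h.weight _)
    (fun i => h.lo_le _) (fun i => (h.lo_pos _).le) (fun i => h.le_hi _) ?_ (fun i => ?_) r
  · obtain ⟨C, hC⟩ := (h.nonnegBdd_u n).bdd
    obtain ⟨D, hD⟩ := (h.nonnegBdd_v n).bdd
    refine ⟨((h.nonnegBdd_u n).measurable.const_mul a).add
      ((h.nonnegBdd_v n).measurable.const_mul b), h0, |a| * C + |b| * D, fun x => ?_⟩
    refine add_le_add ?_ ?_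
    · exact mul_le_mul (le_abs_self a) (hC x) ((h.nonnegBdd_u n).nonneg x) (abs_nonneg a)
    · exact mul_le_mul (le_abs_self b) (hD x) ((h.nonnegBdd_v n).nonneg x) (abs_nonneg b)
  · simp only [← add_assoc, h.u_succ, h.v_succ]
    rw [transfer_lincomb Q (h.weight _) (h.nonnegBdd_u _) (h.nonnegBdd_v _)]

/-- The two bounds mean `u - l v ≥ 0` and `L v - u ≥ 0`, which positive operators preserve. -/
theorem ratio_mem_Icc_add {l L : ℝ} {n : ℕ} (hl : ∀ x, u n x / v n x ∈ Set.Icc l L) (r : ℕ)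
    (x : 𝒳) : u (n + r) x / v (n + r) x ∈ Set.Icc l L := by
  have h1 := (h.lincomb_add 1 (-l) n (fun y => by
    have := (le_div_iff₀ (h.v_pos n y)).1 (hl y).1
    linarith) r).1.nonneg x
  have h2 := (h.lincomb_add (-1) L n (fun y => by
    have := (div_le_iff₀ (h.v_pos n y)).1 (hl y).2
    linarith) r).1.nonneg x
  constructor
  · rw [le_div_iff₀ (h.v_pos _ x)]; linarith
  · rw [div_le_iff₀ (h.v_pos _ x)]; linarith

/-- If the `p`-step kernel is comparable with a fixed measure, `p` steps shrink the range of the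
ratio by a definite factor. -/
theorem ratio_mem_Icc_contract {μ : Measure 𝒳} [IsProbabilityMeasure μ] {p : ℕ} {σ τ : ℝ}
    (hσ : 0 < σ) (hτ : 0 < τ)
    (hK : ∀ f, NonnegBdd f → ∀ x, σ * ∫ y, f y ∂μ ≤ ∫ y, f y ∂(kernelPow Q p x) ∧
      ∫ y, f y ∂(kernelPow Q p x) ≤ τ * ∫ y, f y ∂μ)
    {l L : ℝ} {n : ℕ} (hl : ∀ x, u n x / v n x ∈ Set.Icc l L) :
    ∃ l' L', L' - l' = (1 - σ / τ * ∏ i ∈ Finset.range p, lo (n + i) / hi (n + i)) * (L - l) ∧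
      ∀ x, u (n + p) x / v (n + p) x ∈ Set.Icc l' L' := by
  have p1 : ∀ y, 0 ≤ 1 * u n y + (-l) * v n y := fun y => by
    have := (le_div_iff₀ (h.v_pos n y)).1 (hl y).1
    linarith
  have p2 : ∀ y, 0 ≤ (-1) * u n y + L * v n y := fun y => by
    have := (div_le_iff₀ (h.v_pos n y)).1 (hl y).2
    linarith
  have p3 : ∀ y, 0 ≤ 0 * u n y + 1 * v n y := fun y => by
    have := h.v_pos n y
    linarith
  have h1 := (h.lincomb_add 1 (-l) n p1 p).2
  have h2 := (h.lincomb_add (-1) L n p2 p).2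
  have h3 := (h.lincomb_add 0 1 n p3 p).2
  -- Zero further steps: only the `NonnegBdd` part is wanted here.
  have k1 := hK _ (h.lincomb_add 1 (-l) n p1 0).1
  have k2 := hK _ (h.lincomb_add (-1) L n p2 0).1
  have k3 := hK _ (h.lincomb_add 0 1 n p3 0).1
  simp only [add_zero] at k1 k2 k3
  have iu := (h.nonnegBdd_u n).integrable μ
  have iv := (h.nonnegBdd_v n).integrable μ
  have e : ∀ a b : ℝ, ∫ y, (a * u n y + b * v n y) ∂μ = a * ∫ y, u n y ∂μ + b * ∫ y, v n y ∂μ := by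
    intro a b
    rw [integral_add (iu.const_mul a) (iv.const_mul b), integral_const_mul, integral_const_mul]
  simp only [e] at k1 k2 k3
  set I := ∫ y, u n y ∂μ
  set J := ∫ y, v n y ∂μ
  have hJ : 0 < J := by
    refine (integral_pos_iff_support_of_nonneg (h.nonnegBdd_v n).nonneg iv).2 ?_
    rw [Function.support_eq_univ fun y => (h.v_pos n y).ne']
    simp
  have hI1 : 0 ≤ 1 * I + -l * J := by
    rw [← e]; exact integral_nonneg p1
  have hI2 : 0 ≤ (-1) * I + L * J := by
    rw [← e]; exact integral_nonneg p2
  rw [Finset.prod_div_distrib]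
  set A := ∏ i ∈ Finset.range p, lo (n + i)
  set B := ∏ i ∈ Finset.range p, hi (n + i)
  have hA : 0 < A := Finset.prod_pos fun i _ => h.lo_pos _
  by_cases hne : Nonempty 𝒳
  swap
  · exact ⟨0, (1 - σ / τ * (A / B)) * (L - l), by ring, fun x => (hne ⟨x⟩).elim⟩
  have hB : 0 < B := Finset.prod_pos fun i _ =>
    (h.lo_pos _).trans_le ((h.lo_le _ hne.some).trans (h.le_hi _ hne.some))
  set ε := σ / τ * (A / B) with hε
  have hεpos : 0 < ε := by positivity
  have hετ : ε * (B * τ) = A * σ := by rw [hε]; field_simp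
  -- Each endpoint moves by `ε` times its distance to the mean ratio `I / J`; the two distances add
  -- up to `L - l`.
  refine ⟨l + ε * ((1 * I + -l * J) / J), L - ε * (((-1) * I + L * J) / J), ?_, fun x => ?_⟩
  · field_simp; ring
  have hv := h.v_pos (n + p) x
  have hvle : v (n + p) x ≤ B * (τ * J) := by
    have a1 := (h3 x).2
    have a2 := mul_le_mul_of_nonneg_left (k3 x).2 hB.le
    linarith
  -- The choice of `ε` balances the lower constant `A σ` for the combinations against the upper
  -- constant `B τ` for `v`.
  have key : ∀ t : ℝ, 0 ≤ t → ε * (t / J) * v (n + p) x ≤ A * (σ * t) := by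
    intro t ht
    calc ε * (t / J) * v (n + p) x ≤ ε * (t / J) * (B * (τ * J)) := by gcongr
      _ = (ε * (B * τ)) * t := by field_simp
      _ = A * (σ * t) := by rw [hετ]; ring
  constructor
  · rw [le_div_iff₀ hv]
    have a1 := (h1 x).1
    have a2 := mul_le_mul_of_nonneg_left (k1 x).1 hA.le
    have a3 := key _ hI1
    linarith
  · rw [div_le_iff₀ hv]
    have a1 := (h2 x).1
    have a2 := mul_le_mul_of_nonneg_left (k2 x).1 hA.le
    have a3 := key _ hI2
    linarith

/-- Boundedness, inherited from stage zero, is what makes the real-valued infimum and supremum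
genuine bounds. -/
theorem ratio_mem_Icc_ciInf_ciSup {l L : ℝ} (hl : ∀ x, u 0 x / v 0 x ∈ Set.Icc l L) (n : ℕ)
    (x : 𝒳) : u n x / v n x ∈ Set.Icc (⨅ y, u n y / v n y) (⨆ y, u n y / v n y) := by
  have hb : ∀ y, u n y / v n y ∈ Set.Icc l L := fun y => by
    simpa using h.ratio_mem_Icc_add hl n y
  exact ⟨ciInf_le ⟨l, by rintro _ ⟨y, rfl⟩; exact (hb y).1⟩ x,
    le_ciSup (f := fun y => u n y / v n y) ⟨L, by rintro _ ⟨y, rfl⟩; exact (hb y).2⟩ x⟩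

end TransferPair

theorem ciSup_sub_ciInf_le {ι : Type*} [Nonempty ι] {f : ι → ℝ} {l L : ℝ}
    (h : ∀ i, f i ∈ Set.Icc l L) : (⨆ i, f i) - (⨅ i, f i) ≤ L - l :=
  sub_le_sub (ciSup_le fun i => (h i).2) (le_ciInf fun i => (h i).1)

/-- A nonincreasing sequence that shrinks by `1 - ε n` between times `n` and `n + p`. -/
theorem pow_le_exp_of_contract {D ε : ℕ → ℝ} {p : ℕ} (hp : 1 ≤ p) (hD : ∀ n, 0 ≤ D n)
    (hanti : Antitone D) (hε1 : ∀ n, ε n ≤ 1)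
    (hc : ∀ n, D (n + p) ≤ (1 - ε n) * D n) (n : ℕ) :
    D n ^ p ≤ Real.exp (p - ∑ j ∈ Finset.range n, ε j) * D 0 ^ p := by
  -- Moving a window of `p` consecutive terms by one replaces `D n` by `D (n + p)`, at most `(1 - ε
  -- n) D n`. Thus every `ε n` counts, not only one in `p`.
  have hprod : ∀ n, ∏ i ∈ Finset.range p, D (n + i) ≤
      Real.exp (-∑ j ∈ Finset.range n, ε j) * D 0 ^ p := by
    intro n
    induction n with
    | zero =>
      simp only [zero_add, Finset.range_zero, Finset.sum_empty, neg_zero, Real.exp_zero, one_mul]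
      calc ∏ i ∈ Finset.range p, D i ≤ ∏ _i ∈ Finset.range p, D 0 :=
            Finset.prod_le_prod (fun i _ => hD i) fun i _ => hanti (Nat.zero_le i)
        _ = D 0 ^ p := by simp
    | succ n ih =>
      obtain ⟨q, rfl⟩ : ∃ q, p = q + 1 := ⟨p - 1, by omega⟩
      have e1 : ∏ i ∈ Finset.range (q + 1), D (n + 1 + i) =
          (∏ i ∈ Finset.range q, D (n + (i + 1))) * D (n + (q + 1)) := by
        rw [Finset.prod_range_succ]
        simp only [add_assoc, add_comm 1]
      have e2 : ∏ i ∈ Finset.range (q + 1), D (n + i) =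
          (∏ i ∈ Finset.range q, D (n + (i + 1))) * D n := by
        rw [Finset.prod_range_succ', add_zero]
      have hP : 0 ≤ ∏ i ∈ Finset.range q, D (n + (i + 1)) :=
        Finset.prod_nonneg fun i _ => hD _
      have hx : 1 - ε n ≤ Real.exp (-ε n) := by linarith [Real.add_one_le_exp (-ε n)]
      calc ∏ i ∈ Finset.range (q + 1), D (n + 1 + i)
          ≤ (∏ i ∈ Finset.range q, D (n + (i + 1))) * (Real.exp (-ε n) * D n) := by
            rw [e1]
            exact mul_le_mul_of_nonneg_left
              ((hc n).trans (mul_le_mul_of_nonneg_right hx (hD n))) hP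
        _ = Real.exp (-ε n) * ∏ i ∈ Finset.range (q + 1), D (n + i) := by rw [e2]; ring
        _ ≤ Real.exp (-ε n) * (Real.exp (-∑ j ∈ Finset.range n, ε j) * D 0 ^ (q + 1)) := by
            gcongr
        _ = _ := by
            rw [← mul_assoc, ← Real.exp_add, Finset.sum_range_succ]; congr 2; ring
  -- For `n < p` the exponent is nonnegative and monotonicity suffices. Otherwise the last `p` of
  -- the `ε j`, each at most 1, are absorbed by the summand `p`.
  rcases lt_or_ge n p with hnp | hnp
  · have hs : ∑ j ∈ Finset.range n, ε j ≤ p := by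
      calc ∑ j ∈ Finset.range n, ε j ≤ ∑ _j ∈ Finset.range n, (1 : ℝ) :=
            Finset.sum_le_sum fun j _ => hε1 j
        _ ≤ p := by simpa using hnp.le
    have h1 : 1 ≤ Real.exp (p - ∑ j ∈ Finset.range n, ε j) := Real.one_le_exp (by linarith)
    calc D n ^ p ≤ D 0 ^ p := pow_le_pow_left₀ (hD n) (hanti (Nat.zero_le n)) p
      _ ≤ _ := le_mul_of_one_le_left (pow_nonneg (hD 0) p) h1
  · obtain ⟨r, rfl⟩ := Nat.exists_eq_add_of_le' hnp
    calc D (r + p) ^ p = ∏ _i ∈ Finset.range p, D (r + p) := by simp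
      _ ≤ ∏ i ∈ Finset.range p, D (r + i) := Finset.prod_le_prod (fun i _ => hD _) fun i hi =>
          hanti (by have := Finset.mem_range.1 hi; omega)
      _ ≤ Real.exp (-∑ j ∈ Finset.range r, ε j) * D 0 ^ p := hprod r
      _ ≤ _ := by
        refine mul_le_mul_of_nonneg_right (Real.exp_le_exp.2 ?_) (pow_nonneg (hD 0) p)
        rw [Finset.sum_range_add]
        have hs : ∑ j ∈ Finset.range p, ε (r + j) ≤ p := by
          calc ∑ j ∈ Finset.range p, ε (r + j) ≤ ∑ _j ∈ Finset.range p, (1 : ℝ) :=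
                Finset.sum_le_sum fun j _ => hε1 _
            _ = p := by simp
        linarith

namespace TransferPair

variable {𝒳 : Type*} [MeasurableSpace 𝒳] {Q : Kernel 𝒳 𝒳} [IsMarkovKernel Q] {G : ℕ → 𝒳 → ℝ}
  {lo hi : ℕ → ℝ} {u v : ℕ → 𝒳 → ℝ}

/-- Geometric forgetting of the initial state. -/
theorem abs_ratio_sub_pow_le (h : TransferPair Q G lo hi u v) {μ : Measure 𝒳}
    [IsProbabilityMeasure μ] {p : ℕ} (hp : 1 ≤ p) {σ τ : ℝ} (hσ : 0 < σ) (hστ : σ ≤ τ)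
    (hK : ∀ f, NonnegBdd f → ∀ x, σ * ∫ y, f y ∂μ ≤ ∫ y, f y ∂(kernelPow Q p x) ∧
      ∫ y, f y ∂(kernelPow Q p x) ≤ τ * ∫ y, f y ∂μ)
    {l L : ℝ} (hl : ∀ x, u 0 x / v 0 x ∈ Set.Icc l L) (n : ℕ) :
    ∃ a b : ℝ, (∀ m, n ≤ m → ∀ x, u m x / v m x ∈ Set.Icc a b) ∧ 0 ≤ b - a ∧
      (b - a) ^ p ≤ Real.exp (p - ∑ j ∈ Finset.range n,
        σ / τ * ∏ i ∈ Finset.range p, lo (j + i) / hi (j + i)) * (L - l) ^ p := by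
  have hne : Nonempty 𝒳 := by
    by_contra hne
    rw [not_nonempty_iff] at hne
    have := measure_univ (μ := μ)
    simp [Set.univ_eq_empty_iff.2 hne] at this
  have hτ := hσ.trans_le hστ
  have hhi : ∀ n, 0 < hi n := fun n =>
    (h.lo_pos n).trans_le ((h.lo_le n hne.some).trans (h.le_hi n hne.some))
  have hR := h.ratio_mem_Icc_ciInf_ciSup hl
  set D : ℕ → ℝ := fun n => (⨆ y, u n y / v n y) - ⨅ y, u n y / v n y with hDdef
  have hD : ∀ n, 0 ≤ D n := fun n =>
    sub_nonneg.2 ((hR n hne.some).1.trans (hR n hne.some).2)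
  have hD0 : D 0 ≤ L - l := ciSup_sub_ciInf_le hl
  have hpow := pow_le_exp_of_contract
    (ε := fun j => σ / τ * ∏ i ∈ Finset.range p, lo (j + i) / hi (j + i)) hp hD
    (antitone_nat_of_succ_le fun n => ciSup_sub_ciInf_le fun x => h.ratio_mem_Icc_add (hR n) 1 x)
    (fun n => mul_le_one₀ ((div_le_one hτ).2 hστ)
      (Finset.prod_nonneg fun i _ => (div_pos (h.lo_pos _) (hhi _)).le)
      (Finset.prod_le_one (fun i _ => (div_pos (h.lo_pos _) (hhi _)).le) fun i _ =>
        (div_le_one (hhi _)).2 ((h.lo_le _ hne.some).trans (h.le_hi _ hne.some))))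
    (fun n => by
      obtain ⟨l', L', he, hm⟩ := h.ratio_mem_Icc_contract hσ hτ hK (hR n)
      rw [← he]
      exact ciSup_sub_ciInf_le hm) n
  -- The interval is the range of the ratio at stage `n`, from infimum to supremum; it traps all
  -- later stages.
  refine ⟨_, _, fun m hm x => ?_, hD n, hpow.trans ?_⟩
  · obtain ⟨r, rfl⟩ := Nat.exists_eq_add_of_le hm
    exact h.ratio_mem_Icc_add (hR n) r x
  · exact mul_le_mul_of_nonneg_left (pow_le_pow_left₀ (hD 0) hD0 p) (Real.exp_pos _).le

end TransferPair

/-! ### Integrals of products along a chain of states. -/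

section Chain

variable {𝒳 : Type*} [MeasurableSpace 𝒳]

theorem measurable_chain {n : ℕ} {h : ℕ → 𝒳 → 𝒳 → ℝ}
    (hm : ∀ i, Measurable fun a : 𝒳 × 𝒳 => h i a.1 a.2) :
    Measurable fun a : 𝒳 × (Fin n → 𝒳) =>
      ∏ i : Fin n, h i ((Fin.cons a.1 a.2 : Fin (n + 1) → 𝒳) i.castSucc) (a.2 i) := by
  refine Finset.measurable_prod _ fun i _ => ?_
  have hcons : ∀ j : Fin (n + 1), Measurable fun a : 𝒳 × (Fin n → 𝒳) =>
      (Fin.cons a.1 a.2 : Fin (n + 1) → 𝒳) j := by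
    intro j
    refine Fin.cases ?_ (fun j => ?_) j
    · exact measurable_fst
    · exact (measurable_pi_apply j).comp measurable_snd
  exact (hm i).comp (Measurable.prodMk (hcons i.castSucc)
    ((measurable_pi_apply i).comp measurable_snd))

/-- Fubini in the first coordinate; bounded factors and a probability measure supply integrability.
-/
theorem integral_chain_succ (μ : Measure 𝒳) [IsProbabilityMeasure μ] {h : ℕ → 𝒳 → 𝒳 → ℝ}
    (hm : ∀ i, Measurable fun a : 𝒳 × 𝒳 => h i a.1 a.2)
    (hb : ∀ i, ∃ C, ∀ x y, |h i x y| ≤ C) (n : ℕ) (x : 𝒳) :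
    ∫ z : Fin (n + 1) → 𝒳, ∏ i : Fin (n + 1),
        h i ((Fin.cons x z : Fin (n + 2) → 𝒳) i.castSucc) (z i) ∂(Measure.pi fun _ => μ) =
      ∫ y, h 0 x y * ∫ z : Fin n → 𝒳, ∏ i : Fin n,
        h (i + 1) ((Fin.cons y z : Fin (n + 1) → 𝒳) i.castSucc) (z i)
          ∂(Measure.pi fun _ => μ) ∂μ := by
  choose C hC using hb
  have hm' : Measurable fun a : 𝒳 × (Fin n → 𝒳) => ∏ i : Fin n,
      h (i + 1) ((Fin.cons a.1 a.2 : Fin (n + 1) → 𝒳) i.castSucc) (a.2 i) :=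
    measurable_chain (h := fun i => h (i + 1)) fun i => hm (i + 1)
  rw [← ((measurePreserving_piFinSuccAbove (fun _ : Fin (n + 1) => μ) 0).symm).integral_comp']
  simp_rw [MeasurableEquiv.piFinSuccAbove_symm_apply, Fin.insertNthEquiv,
    Fin.prod_univ_succ, Fin.insertNth_zero, Equiv.coe_fn_mk]
  simp only [Fin.castSucc_zero, Fin.cons_zero, Fin.val_zero, Fin.val_succ, Fin.cons_succ,
    Fin.castSucc_succ, cast_eq]
  rw [integral_prod]
  · refine integral_congr_ae (ae_of_all _ fun y => ?_)
    simp only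
    rw [integral_const_mul]
  · refine Integrable.of_bound (C := C 0 * ∏ i : Fin n, C (i + 1)) ?_ (ae_of_all _ fun a => ?_)
    · refine Measurable.aestronglyMeasurable ?_
      exact (((hm 0).comp (measurable_const.prodMk measurable_id)).comp measurable_fst).mul hm'
    · rw [Real.norm_eq_abs, abs_mul, Finset.abs_prod]
      refine mul_le_mul (hC 0 _ _) (Finset.prod_le_prod (fun i _ => abs_nonneg _)
        fun i _ => hC _ _ _) (Finset.prod_nonneg fun i _ => abs_nonneg _)
        ((abs_nonneg _).trans (hC 0 x a.1))

end Chain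

/-! ### Conditional densities as ratios of iterates. -/

namespace Model

variable {Θ 𝒳 𝒴 𝒲 : Type*} [MeasurableSpace 𝒳] [MeasurableSpace 𝒴] [MeasurableSpace 𝒲]
  {s p : ℕ} {M : Model Θ 𝒳 𝒴 𝒲 s}

/-- The emission density `x ↦ g_θ(Y_t | Ȳ_{t-1}, x, W_t)` along a trajectory. -/
noncomputable def weight (M : Model Θ 𝒳 𝒴 𝒲 s) (θ : Θ) (ω : Path 𝒳 𝒴 𝒲) (t : ℤ) (x : 𝒳) : ℝ :=
  M.g θ (Y t ω) (Ybar s (t - 1) ω) x (W t ω)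

theorem measurable_weight (θ : Θ) (ω : Path 𝒳 𝒴 𝒲) (t : ℤ) : Measurable (M.weight θ ω t) :=
  (M.measurable_g θ).comp (measurable_const.prodMk (measurable_const.prodMk
    (measurable_id.prodMk measurable_const)))

theorem EmissionBounds.bMinus_le (hg : M.EmissionBounds) (θ : Θ) (ω : Path 𝒳 𝒴 𝒲) (t : ℤ)
    (x : 𝒳) : M.bMinus t ω ≤ M.weight θ ω t x := by
  obtain ⟨⟨c, -, hc⟩, -⟩ := hg (Y t ω) (Ybar s (t - 1) ω) (W t ω)
  exact ciInf_le (f := fun a : Θ × 𝒳 => M.weight a.1 ω t a.2)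
    ⟨c, by rintro _ ⟨a, rfl⟩; exact hc _ _⟩ (θ, x)

theorem EmissionBounds.le_bPlus (hg : M.EmissionBounds) (θ : Θ) (ω : Path 𝒳 𝒴 𝒲) (t : ℤ)
    (x : 𝒳) : M.weight θ ω t x ≤ M.bPlus t ω := by
  obtain ⟨-, ⟨c, hc⟩⟩ := hg (Y t ω) (Ybar s (t - 1) ω) (W t ω)
  exact le_ciSup (f := fun a : Θ × 𝒳 => M.weight a.1 ω t a.2)
    ⟨c, by rintro _ ⟨a, rfl⟩; exact hc _ _⟩ (θ, x)

theorem EmissionBounds.bMinus_pos (hg : M.EmissionBounds) [Nonempty Θ] [Nonempty 𝒳]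
    (ω : Path 𝒳 𝒴 𝒲) (t : ℤ) : 0 < M.bMinus t ω := by
  obtain ⟨⟨c, hc0, hc⟩, -⟩ := hg (Y t ω) (Ybar s (t - 1) ω) (W t ω)
  exact hc0.trans_le (le_ciInf fun a => hc a.1 a.2)

theorem EmissionBounds.bMinus_le_bPlus (hg : M.EmissionBounds) [Nonempty Θ] [Nonempty 𝒳]
    (ω : Path 𝒳 𝒴 𝒲) (t : ℤ) : M.bMinus t ω ≤ M.bPlus t ω :=
  (hg.bMinus_le (Classical.arbitrary Θ) ω t (Classical.arbitrary 𝒳)).trans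
    (hg.le_bPlus _ ω t _)

theorem EmissionBounds.nonnegBdd_weight (hg : M.EmissionBounds) [Nonempty Θ] [Nonempty 𝒳] (θ : Θ)
    (ω : Path 𝒳 𝒴 𝒲) (t : ℤ) : NonnegBdd (M.weight θ ω t) :=
  ⟨measurable_weight θ ω t, fun x => (hg.bMinus_pos ω t).le.trans (hg.bMinus_le θ ω t x),
    _, hg.le_bPlus θ ω t⟩

theorem likelihood_zero (θ : Θ) (a : ℤ) (x : 𝒳) (ω : Path 𝒳 𝒴 𝒲) :
    M.likelihood θ a 0 x ω = 1 := by
  simp [likelihood]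

theorem integral_Q (hq : M.TransitionDensities p) (θ : Θ) (x : 𝒳) (f : 𝒳 → ℝ) :
    ∫ y, f y ∂(M.Q θ x) = ∫ y, M.q 1 θ x y * f y ∂M.μ := by
  have h := hq.density 1 le_rfl θ x
  rw [kernelPow_one] at h
  have hm : Measurable fun y => ENNReal.ofReal (M.q 1 θ x y) :=
    ((M.measurable_q 1 θ).comp (measurable_const.prodMk measurable_id)).ennreal_ofReal
  rw [h, integral_withDensity_eq_integral_toReal_smul hm
    (ae_of_all _ fun y => ENNReal.ofReal_lt_top)]
  simp only [ENNReal.toReal_ofReal (hq.nonneg 1 le_rfl θ x _), smul_eq_mul]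

/-- Integrating out the first state last gives the backward recursion. Absorbing `q_θ` into the
kernel lets the `p`-step bounds act through `kernelPow`. -/
theorem likelihood_succ (hq : M.TransitionDensities p) (hg : M.EmissionBounds) [Nonempty Θ]
    [Nonempty 𝒳] (θ : Θ) (a : ℤ) (n : ℕ) (x : 𝒳) (ω : Path 𝒳 𝒴 𝒲) :
    M.likelihood θ a (n + 1) x ω =
      transfer (M.Q θ) (M.weight θ ω (a + 1)) (fun y => M.likelihood θ (a + 1) n y ω) x := by
  obtain ⟨σ₀, hσ₀⟩ := hq.bounded
  have key := integral_chain_succ M.μ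
    (h := fun i x y => M.q 1 θ x y * M.weight θ ω (a + 1 + (i : ℤ)) y)
    (fun i => (M.measurable_q 1 θ).mul ((measurable_weight θ ω _).comp measurable_snd))
    (fun i => ⟨σ₀ * M.bPlus (a + 1 + (i : ℤ)) ω, fun x y => by
      have h1 := hq.nonneg 1 le_rfl θ x y
      have h2 := (hg.nonnegBdd_weight θ ω (a + 1 + (i : ℤ))).nonneg y
      rw [abs_of_nonneg (mul_nonneg h1 h2)]
      exact mul_le_mul (hσ₀ θ x y) (hg.le_bPlus θ ω _ y) h2 (h1.trans (hσ₀ θ x y))⟩) n x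
  have e0 : ∀ (b : ℤ) (j : ℕ) (x y : 𝒳), M.q 1 θ x y * M.weight θ ω (b + 1 + j) y =
      M.q 1 θ x y * M.g θ (Y (b + 1 + j) ω) (Ybar s (b + j) ω) y (W (b + 1 + j) ω) := by
    intro b j x y
    rw [weight, show b + 1 + (j : ℤ) - 1 = b + j by ring]
  have e1 : ∀ j : ℕ, a + 1 + ((j + 1 : ℕ) : ℤ) = a + 1 + 1 + j := fun j => by push_cast; ring
  rw [transfer, integral_Q hq]
  simp only [e1] at key
  simp only [e0] at key
  refine key.trans (integral_congr_ae (ae_of_all _ fun y => ?_))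
  simp only [weight, likelihood, Nat.cast_zero, add_zero, add_sub_cancel_right, mul_assoc]

theorem integral_kernelPow_bounds (hq : M.TransitionDensities p) :
    ∃ σ τ : ℝ, 0 < σ ∧ σ ≤ τ ∧ ∀ θ (f : 𝒳 → ℝ), NonnegBdd f → ∀ x,
      σ * ∫ y, f y ∂M.μ ≤ ∫ y, f y ∂(kernelPow (M.Q θ) p x) ∧
      ∫ y, f y ∂(kernelPow (M.Q θ) p x) ≤ τ * ∫ y, f y ∂M.μ := by
  obtain ⟨σ, hσ, hlo⟩ := hq.minorized
  obtain ⟨τ, hhi⟩ := hq.majorized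
  -- The maximum secures `σ ≤ τ`, so that the contraction coefficient is at most 1.
  refine ⟨σ, max σ τ, hσ, le_max_left _ _, fun θ f hf x => ?_⟩
  have hmq : Measurable fun y => M.q p θ x y :=
    (M.measurable_q p θ).comp (measurable_const.prodMk measurable_id)
  have h0 := hq.nonneg p hq.pos_steps θ x
  rw [hq.density p hq.pos_steps θ x,
    integral_withDensity_eq_integral_toReal_smul hmq.ennreal_ofReal
    (ae_of_all _ fun y => ENNReal.ofReal_lt_top)]
  simp only [ENNReal.toReal_ofReal (h0 _), smul_eq_mul]
  have hi : Integrable (fun y => M.q p θ x y * f y) M.μ :=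
    (NonnegBdd.mul ⟨hmq, h0, τ, hhi θ x⟩ hf).integrable _
  rw [← integral_const_mul, ← integral_const_mul]
  exact ⟨integral_mono ((hf.integrable _).const_mul _) hi fun y =>
      mul_le_mul_of_nonneg_right (hlo θ x y) (hf.nonneg y),
    integral_mono hi ((hf.integrable _).const_mul _) fun y =>
      mul_le_mul_of_nonneg_right ((hhi θ x y).trans (le_max_right _ _)) (hf.nonneg y)⟩

/-- Read backwards from time `k`, numerator and denominator of the conditional density of `Y_k`
are iterates of the same operators. -/
theorem transferPair_likelihood (hq : M.TransitionDensities p) (hg : M.EmissionBounds) [Nonempty Θ]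
    [Nonempty 𝒳] (θ : Θ) (ω : Path 𝒳 𝒴 𝒲) (t : ℤ) :
    TransferPair (M.Q θ) (fun n => M.weight θ ω (t - n)) (fun n => M.bMinus (t - n) ω)
      (fun n => M.bPlus (t - n) ω) (fun n x => M.likelihood θ (t - n) (n + 1) x ω)
      (fun n x => M.likelihood θ (t - n) n x ω) := by
  have e : ∀ n : ℕ, t - ((n + 1 : ℕ) : ℤ) + 1 = t - n := fun n => by push_cast; ring
  have hone : NonnegBdd fun _ : 𝒳 => (1 : ℝ) :=
    ⟨measurable_const, fun _ => zero_le_one, 1, fun _ => le_rfl⟩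
  exact
    { weight := fun n => hg.nonnegBdd_weight θ ω _
      lo_le := fun n => hg.bMinus_le θ ω _
      lo_pos := fun n => hg.bMinus_pos ω _
      le_hi := fun n => hg.le_bPlus θ ω _
      u_zero := by
        have : (fun x => M.likelihood θ (t - (0 : ℕ)) (0 + 1) x ω) =
            transfer (M.Q θ) (M.weight θ ω (t + 1)) fun _ => 1 := by
          funext x
          rw [likelihood_succ hq hg]
          simp only [likelihood_zero, Nat.cast_zero, sub_zero]
        rw [this]
        exact hone.transfer (hg.nonnegBdd_weight θ ω _) _
      v_zero := fun x => likelihood_zero θ _ x ω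
      u_succ := fun n => by
        funext x
        rw [likelihood_succ hq hg, e]
      v_succ := fun n => by
        funext x
        rw [likelihood_succ hq hg, e] }

/-- Time `-m` is stage `m + k - 1` of the recursion that goes back from time `k - 1`; `1 ≤ k` makes
the natural subtraction exact. -/
theorem condDensity_eq (k m : ℕ) (hk : 1 ≤ k) (x : 𝒳) (θ : Θ) (ω : Path 𝒳 𝒴 𝒲) :
    M.condDensity k m x θ ω =
      M.likelihood θ ((k : ℤ) - 1 - ((m + k - 1 : ℕ) : ℤ)) (m + k - 1 + 1) x ω /
        M.likelihood θ ((k : ℤ) - 1 - ((m + k - 1 : ℕ) : ℤ)) (m + k - 1) x ω := by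
  have e : (k : ℤ) - 1 - ((m + k - 1 : ℕ) : ℤ) = -(m : ℤ) := by omega
  have e' : m + k - 1 + 1 = m + k := by omega
  rw [e, e']
  rfl

/-- At stage zero the denominator is 1 and the numerator is a `Q_θ`-average of the emission density
at time `k`. -/
theorem ratio_zero_mem_Icc (hq : M.TransitionDensities p) (hg : M.EmissionBounds) [Nonempty Θ]
    [Nonempty 𝒳] (θ : Θ) (ω : Path 𝒳 𝒴 𝒲) (k : ℕ) (x : 𝒳) :
    M.likelihood θ ((k : ℤ) - 1 - ((0 : ℕ) : ℤ)) (0 + 1) x ω /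
      M.likelihood θ ((k : ℤ) - 1 - ((0 : ℕ) : ℤ)) 0 x ω ∈ Set.Icc (M.bMinus k ω) (M.bPlus k ω) := by
  have hw := hg.nonnegBdd_weight θ ω k
  rw [likelihood_zero, div_one, likelihood_succ hq hg]
  simp only [likelihood_zero, Nat.cast_zero, sub_zero, sub_add_cancel, transfer, mul_one]
  constructor
  · calc M.bMinus k ω = ∫ _, M.bMinus k ω ∂(M.Q θ x) := by simp
      _ ≤ _ := integral_mono (integrable_const _) (hw.integrable _) (hg.bMinus_le θ ω k)
  · calc _ ≤ ∫ _, M.bPlus k ω ∂(M.Q θ x) :=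
          integral_mono (hw.integrable _) (integrable_const _) (hg.le_bPlus θ ω k)
      _ = M.bPlus k ω := by simp

theorem condDensity_mem_Icc (hq : M.TransitionDensities p) (hg : M.EmissionBounds) [Nonempty Θ]
    [Nonempty 𝒳] (θ : Θ) (ω : Path 𝒳 𝒴 𝒲) {k : ℕ} (hk : 1 ≤ k) (m : ℕ) (x : 𝒳) :
    M.condDensity k m x θ ω ∈ Set.Icc (M.bMinus k ω) (M.bPlus k ω) := by
  rw [condDensity_eq k m hk]
  have := (transferPair_likelihood hq hg θ ω ((k : ℤ) - 1)).ratio_mem_Icc_add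
    (ratio_zero_mem_Icc hq hg θ ω k) (m + k - 1) x
  simpa only [zero_add] using this

theorem measurable_condDensity (hq : M.TransitionDensities p) (hg : M.EmissionBounds) [Nonempty Θ]
    [Nonempty 𝒳] (θ : Θ) (ω : Path 𝒳 𝒴 𝒲) {k : ℕ} (hk : 1 ≤ k) (m : ℕ) :
    Measurable fun x => M.condDensity k m x θ ω := by
  have h := transferPair_likelihood hq hg θ ω ((k : ℤ) - 1)
  simp only [condDensity_eq k m hk]
  exact (h.nonnegBdd_u (m + k - 1)).measurable.div (h.nonnegBdd_v (m + k - 1)).measurable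

theorem integrable_condDensity (hq : M.TransitionDensities p) (hg : M.EmissionBounds) [Nonempty Θ]
    [Nonempty 𝒳] (θ : Θ) (ω : Path 𝒳 𝒴 𝒲) {k : ℕ} (hk : 1 ≤ k) (m : ℕ) (π : Measure 𝒳)
    [IsFiniteMeasure π] : Integrable (fun x => M.condDensity k m x θ ω) π :=
  NonnegBdd.integrable ⟨measurable_condDensity hq hg θ ω hk m, fun x =>
    (hg.bMinus_pos ω k).le.trans (condDensity_mem_Icc hq hg θ ω hk m x).1, _, fun x =>
    (condDensity_mem_Icc hq hg θ ω hk m x).2⟩ π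

/-- An average of the conditional densities lies in every interval that contains them all. -/
theorem integral_condDensity_mem_Icc (hq : M.TransitionDensities p) (hg : M.EmissionBounds)
    [Nonempty Θ] [Nonempty 𝒳] (θ : Θ) (ω : Path 𝒳 𝒴 𝒲) {k : ℕ} (hk : 1 ≤ k) (m : ℕ)
    (π : Measure 𝒳) [IsProbabilityMeasure π] {a b : ℝ}
    (h : ∀ x, M.condDensity k m x θ ω ∈ Set.Icc a b) :
    ∫ x, M.condDensity k m x θ ω ∂π ∈ Set.Icc a b := by
  have hi := integrable_condDensity hq hg θ ω hk m π
  constructor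
  · calc a = ∫ _, a ∂π := by simp
      _ ≤ _ := integral_mono (integrable_const _) hi fun x => (h x).1
  · calc _ ≤ ∫ _, b ∂π := integral_mono hi (integrable_const _) fun x => (h x).2
      _ = b := by simp

/-- The coefficient by which the dependence on the state at time `t - p` is reduced. -/
noncomputable def mixing (M : Model Θ 𝒳 𝒴 𝒲 s) (p : ℕ) (r : ℝ) (t : ℤ) (ω : Path 𝒳 𝒴 𝒲) : ℝ :=
  r * ∏ i ∈ Finset.range p, M.bMinus (t - (i : ℤ)) ω / M.bPlus (t - (i : ℤ)) ω

/-- All conditional densities of `Y_k` given a past of length at least `m` lie in an interval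
whose length decays with the accumulated mixing. -/
theorem exists_Icc_condDensity (hq : M.TransitionDensities p) (hg : M.EmissionBounds) [Nonempty Θ]
    [Nonempty 𝒳] : ∃ r : ℝ, 0 < r ∧ r ≤ 1 ∧
    ∀ (θ : Θ) (ω : Path 𝒳 𝒴 𝒲) (k m : ℕ), 1 ≤ k → ∃ a b : ℝ,
      (∀ m', m ≤ m' → ∀ x, M.condDensity k m' x θ ω ∈ Set.Icc a b) ∧ 0 ≤ b - a ∧
      (b - a) ^ p ≤ Real.exp (p - ∑ j ∈ Finset.range (m + k - 1),
        M.mixing p r ((k : ℤ) - 1 - j) ω) * M.bPlus k ω ^ p := by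
  obtain ⟨σ, τ, hσ, hστ, hK⟩ := integral_kernelPow_bounds hq
  have hτ := hσ.trans_le hστ
  refine ⟨σ / τ, by positivity, (div_le_one hτ).2 hστ, fun θ ω k m hk => ?_⟩
  obtain ⟨a, b, h1, h2, h3⟩ := (transferPair_likelihood hq hg θ ω ((k : ℤ) - 1)).abs_ratio_sub_pow_le
    hq.pos_steps hσ hστ (hK θ) (ratio_zero_mem_Icc hq hg θ ω k) (m + k - 1)
  refine ⟨a, b, fun m' hm' x => ?_, h2, ?_⟩
  · rw [condDensity_eq k m' hk]
    exact h1 _ (by omega) x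
  · have hb := hg.bMinus_pos ω k
    have hb' := hg.bMinus_le_bPlus ω k
    have e : ∀ j i : ℕ, (k : ℤ) - 1 - ((j + i : ℕ) : ℤ) = (k : ℤ) - 1 - j - i := fun j i => by
      push_cast; ring
    simp only [e] at h3
    refine h3.trans (mul_le_mul_of_nonneg_left ?_ (Real.exp_pos _).le)
    -- The initial width `b_+ - b_-` is at most `b_+`.
    exact pow_le_pow_left₀ (by linarith) (by linarith) p

end Model

/-! ### A one-sided ergodic theorem from the maximal inequality. -/

section MaximalErgodic

variable {Ω : Type*} {mΩ : MeasurableSpace Ω} {P : Measure Ω} {T : Ω → Ω}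

/-- The running maximum of the Birkhoff sums `0, f, f + f ∘ T, …`. -/
noncomputable def birkhoffMax (T : Ω → Ω) (f : Ω → ℝ) : ℕ → Ω → ℝ
  | 0 => fun _ => 0
  | n + 1 => fun x => max 0 (f x + birkhoffMax T f n (T x))

theorem birkhoffMax_nonneg (f : Ω → ℝ) (n : ℕ) (x : Ω) : 0 ≤ birkhoffMax T f n x := by
  cases n with
  | zero => exact le_rfl
  | succ n => exact le_max_left _ _

theorem birkhoffMax_le_succ (f : Ω → ℝ) (n : ℕ) (x : Ω) :
    birkhoffMax T f n x ≤ birkhoffMax T f (n + 1) x := by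
  induction n generalizing x with
  | zero => exact birkhoffMax_nonneg f 1 x
  | succ n ih => exact max_le_max le_rfl (add_le_add le_rfl (ih (T x)))

theorem birkhoffSum_le_birkhoffMax (f : Ω → ℝ) (n : ℕ) (x : Ω) :
    birkhoffSum T f n x ≤ birkhoffMax T f n x := by
  induction n generalizing x with
  | zero => simp [birkhoffMax]
  | succ n ih =>
    rw [birkhoffSum_succ']
    exact (add_le_add le_rfl (ih (T x))).trans (le_max_right _ _)

theorem integrable_birkhoffMax (hT : MeasurePreserving T P P) {f : Ω → ℝ} (hf : Integrable f P)
    (n : ℕ) : Integrable (birkhoffMax T f n) P := by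
  induction n with
  | zero => exact integrable_zero _ _ _
  | succ n ih =>
    exact (integrable_zero _ _ _).sup (hf.add (hT.integrable_comp_of_integrable ih))

theorem measurable_birkhoffMax (hT : Measurable T) {f : Ω → ℝ} (hf : Measurable f)
    (n : ℕ) : Measurable (birkhoffMax T f n) := by
  induction n with
  | zero => exact measurable_const
  | succ n ih => exact measurable_const.max (hf.add (ih.comp hT))

/-- **Maximal ergodic theorem** (Garsia). -/
theorem integral_indicator_birkhoffMax_nonneg (hT : MeasurePreserving T P P) {f : Ω → ℝ}
    (hfm : Measurable f) (hf : Integrable f P) (n : ℕ) :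
    0 ≤ ∫ x, {x | 0 < birkhoffMax T f (n + 1) x}.indicator f x ∂P := by
  have hi := integrable_birkhoffMax hT hf (n + 1)
  have hm := measurable_birkhoffMax hT.measurable hfm (n + 1)
  have hc : ∫ x, birkhoffMax T f (n + 1) (T x) ∂P = ∫ x, birkhoffMax T f (n + 1) x ∂P := by
    conv_rhs => rw [← hT.map_eq]
    exact (integral_map hT.measurable.aemeasurable hm.aestronglyMeasurable).symm
  have hi' : Integrable (fun x => birkhoffMax T f (n + 1) (T x)) P :=
    hT.integrable_comp_of_integrable hi
  calc (0 : ℝ) = ∫ x, (birkhoffMax T f (n + 1) x - birkhoffMax T f (n + 1) (T x)) ∂P := by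
        rw [integral_sub hi hi', hc, sub_self]
    _ ≤ _ := by
        -- Where the maximum is positive it equals `f` plus the previous maximum at `T x`, and
        -- maxima increase with `n`. Elsewhere it vanishes and the difference is nonpositive.
        refine integral_mono (hi.sub hi')
          (hf.indicator (measurableSet_lt measurable_const hm)) fun x => ?_
        have h1 := birkhoffMax_le_succ (T := T) f n (T x)
        by_cases hx : 0 < birkhoffMax T f (n + 1) x
        · rw [Set.indicator_of_mem (by exact hx)]
          have h2 : birkhoffMax T f (n + 1) x = f x + birkhoffMax T f n (T x) := by
            rcases max_choice 0 (f x + birkhoffMax T f n (T x)) with h | h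
            · exact absurd h (ne_of_gt hx)
            · exact h
          simp only
          linarith
        · rw [Set.indicator_of_notMem (by exact hx)]
          have h2 := birkhoffMax_nonneg (T := T) f (n + 1) (T x)
          simp only
          linarith

theorem measurable_birkhoffSum (hT : Measurable T) {f : Ω → ℝ} (hf : Measurable f) (n : ℕ) :
    Measurable (birkhoffSum T f n) := by
  unfold birkhoffSum
  exact Finset.measurable_fun_sum _ fun i _ => hf.comp (hT.iterate i)

/-- The Birkhoff sums of a function of negative mean are almost surely bounded above. -/
theorem ae_bddAbove_birkhoffSum [IsProbabilityMeasure P] (hT : Ergodic T P) {f : Ω → ℝ}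
    (hf : Integrable f P) (hneg : ∫ x, f x ∂P < 0) :
    ∀ᵐ x ∂P, ∃ C : ℝ, ∀ n, birkhoffSum T f n x ≤ C := by
  have hmeas : ∀ f : Ω → ℝ, Measurable f → Integrable f P → ∫ x, f x ∂P < 0 →
      ∀ᵐ x ∂P, ∃ C : ℝ, ∀ n, birkhoffSum T f n x ≤ C := by
    clear hf hneg f
    intro f hfm hf hneg
    have heq : {x | ∃ C : ℝ, ∀ n, birkhoffSum T f n x ≤ C} =
        ⋃ N : ℕ, ⋂ n, {x | birkhoffSum T f n x ≤ N} := by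
      ext x
      simp only [Set.mem_ofPred_eq, Set.mem_iUnion, Set.mem_iInter]
      refine ⟨fun ⟨C, hC⟩ => ?_, fun ⟨N, hN⟩ => ⟨N, hN⟩⟩
      obtain ⟨N, hN⟩ := exists_nat_ge C
      exact ⟨N, fun n => (hC n).trans hN⟩
    have hms : MeasurableSet {x | ∃ C : ℝ, ∀ n, birkhoffSum T f n x ≤ C} := by
      rw [heq]
      exact MeasurableSet.iUnion fun N => MeasurableSet.iInter fun n =>
        measurableSet_le (measurable_birkhoffSum hT.measurable hfm n) measurable_const
    have hinv : T ⁻¹' {x | ∃ C : ℝ, ∀ n, birkhoffSum T f n x ≤ C} =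
        {x | ∃ C : ℝ, ∀ n, birkhoffSum T f n x ≤ C} := by
      ext x
      simp only [Set.mem_preimage, Set.mem_ofPred_eq]
      constructor
      · rintro ⟨C, hC⟩
        refine ⟨max 0 (f x + C), fun n => ?_⟩
        cases n with
        | zero => simp
        | succ n =>
          rw [birkhoffSum_succ']
          exact (add_le_add le_rfl (hC n)).trans (le_max_right _ _)
      · rintro ⟨C, hC⟩
        refine ⟨C - f x, fun n => ?_⟩
        have := hC (n + 1)
        rw [birkhoffSum_succ'] at this
        linarith
    rcases hT.toPreErgodic.ae_mem_or_ae_notMem hms hinv with h | h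
    · exact h
    · exfalso
      -- The bounded set is invariant, so otherwise almost every orbit has unbounded sums. Then the
      -- running maximum is eventually positive, the indicators tend to `f`, and the maximal
      -- inequality gives `∫ f ≥ 0`.
      refine absurd hneg (not_lt.2 ?_)
      have hlim : Tendsto
          (fun n => ∫ x, {x | 0 < birkhoffMax T f (n + 1) x}.indicator f x ∂P) atTop
          (𝓝 (∫ x, f x ∂P)) := by
        refine tendsto_integral_of_dominated_convergence (fun x => ‖f x‖) (fun n => ?_) hf.norm
          (fun n => ae_of_all _ fun x => norm_indicator_le_norm_self _ _) ?_
        · exact (hfm.indicator (measurableSet_lt measurable_const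
            (measurable_birkhoffMax hT.measurable hfm (n + 1)))).aestronglyMeasurable
        · filter_upwards [h] with x hx
          have hx' : ∃ n, 0 < birkhoffSum T f n x := by
            by_contra! hcon
            exact hx ⟨0, hcon⟩
          obtain ⟨N, hN⟩ := hx'
          refine tendsto_const_nhds.congr' ?_
          filter_upwards [eventually_ge_atTop N] with n hn
          rw [Set.indicator_of_mem]
          have hmono : Monotone fun n => birkhoffMax T f n x :=
            monotone_nat_of_le_succ fun n => birkhoffMax_le_succ f n x
          exact (hN.trans_le (birkhoffSum_le_birkhoffMax f N x)).trans_le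
            (hmono (hn.trans (Nat.le_succ n)))
      exact ge_of_tendsto' hlim fun n =>
        integral_indicator_birkhoffMax_nonneg hT.toMeasurePreserving hfm hf n
  have hmk : f =ᵐ[P] hf.aemeasurable.mk f := hf.aemeasurable.ae_eq_mk
  have h1 := hmeas _ hf.aemeasurable.measurable_mk (hf.congr hmk)
    (by rwa [← integral_congr_ae hmk])
  have h2 : ∀ᵐ x ∂P, ∀ n, birkhoffSum T f n x = birkhoffSum T (hf.aemeasurable.mk f) n x :=
    ae_all_iff.2 fun n => hT.toMeasurePreserving.quasiMeasurePreserving.birkhoffSum_ae_eq_of_ae_eq hmk n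
  filter_upwards [h1, h2] with x ⟨C, hC⟩ hx
  exact ⟨C, fun n => (hx n).le.trans (hC n)⟩

/-- The function `c - f` has negative mean. This half of the pointwise ergodic theorem suffices for
the mixing sums. -/
theorem ae_linear_lower_bound_birkhoffSum [IsProbabilityMeasure P] (hT : Ergodic T P) {f : Ω → ℝ}
    (hf : Integrable f P) {c : ℝ} (hc : c < ∫ x, f x ∂P) :
    ∀ᵐ x ∂P, ∃ C : ℝ, ∀ n : ℕ, c * n - C ≤ ∑ i ∈ Finset.range n, f (T^[i] x) := by
  have h := ae_bddAbove_birkhoffSum hT (f := fun x => c - f x) ((integrable_const c).sub hf) (by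
    rw [integral_sub (integrable_const c) hf]; simp; linarith)
  filter_upwards [h] with x ⟨C, hC⟩
  refine ⟨C, fun n => ?_⟩
  have := hC n
  simp only [birkhoffSum, Finset.sum_sub_distrib, Finset.sum_const, Finset.card_range,
    nsmul_eq_mul] at this
  linarith

end MaximalErgodic

/-! ### Translations of trajectories, forwards and backwards. -/

section Translate

variable {𝒳 𝒴 𝒲 : Type*} [MeasurableSpace 𝒳] [MeasurableSpace 𝒴] [MeasurableSpace 𝒲]

/-- Translation of trajectories by `a` time units. -/
def translate (a : ℤ) : Path 𝒳 𝒴 𝒲 ≃ᵐ Path 𝒳 𝒴 𝒲 where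
  toFun ω := fun k => ω (k + a)
  invFun ω := fun k => ω (k - a)
  left_inv ω := by funext k; simp
  right_inv ω := by funext k; simp
  measurable_toFun := measurable_pi_lambda _ fun k => measurable_pi_apply _
  measurable_invFun := measurable_pi_lambda _ fun k => measurable_pi_apply _

theorem translate_apply (a : ℤ) (ω : Path 𝒳 𝒴 𝒲) (k : ℤ) : translate a ω k = ω (k + a) := rfl

theorem coe_translate_one : ⇑(translate 1 : Path 𝒳 𝒴 𝒲 ≃ᵐ Path 𝒳 𝒴 𝒲) = shift := rfl

theorem iterate_translate (a : ℤ) (n : ℕ) (ω : Path 𝒳 𝒴 𝒲) :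
    (translate a)^[n] ω = translate (n * a) ω := by
  induction n generalizing ω with
  | zero => funext k; simp [translate_apply]
  | succ n ih =>
    rw [Function.iterate_succ_apply, ih]
    funext k
    simp only [translate_apply]
    congr 1
    push_cast
    ring

theorem translate_symm (a : ℤ) :
    (translate a : Path 𝒳 𝒴 𝒲 ≃ᵐ Path 𝒳 𝒴 𝒲).symm = translate (-a) := by
  ext1
  rfl

theorem measurePreserving_translate {P : Measure (Path 𝒳 𝒴 𝒲)} (h : MeasurePreserving shift P P)
    (a : ℤ) : MeasurePreserving (translate a) P P := by
  have hnat : ∀ n : ℕ, MeasurePreserving (translate (n : ℤ)) P P := fun n => by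
    have hn := h.iterate n
    rw [← coe_translate_one] at hn
    convert hn using 1
    funext ω
    rw [iterate_translate, mul_one]
  obtain ⟨n, rfl | rfl⟩ := a.eq_nat_or_neg
  · exact hnat n
  · rw [← translate_symm]
    exact (hnat n).symm

theorem ergodic_translate_neg_one {P : Measure (Path 𝒳 𝒴 𝒲)} (h : Ergodic shift P) :
    Ergodic (translate (-1)) P := by
  rw [← coe_translate_one] at h
  rw [← translate_symm]
  exact h.symm

end Translate

/-! ### Accumulated mixing and growth of the emission ratios. -/

namespace Model

variable {Θ 𝒳 𝒴 𝒲 : Type*} [MeasurableSpace 𝒳] [MeasurableSpace 𝒴] [MeasurableSpace 𝒲]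
  {s p : ℕ} {M : Model Θ 𝒳 𝒴 𝒲 s} {θs : Θ}

theorem Ybar_translate (t a : ℤ) (ω : Path 𝒳 𝒴 𝒲) :
    Ybar s t (translate a ω) = Ybar s (t + a) ω := by
  funext i
  simp only [Ybar, Y, translate_apply]
  congr 3
  ring

theorem bPlus_translate (t a : ℤ) (ω : Path 𝒳 𝒴 𝒲) :
    M.bPlus t (translate a ω) = M.bPlus (t + a) ω := by
  simp only [bPlus, Ybar_translate, show t - 1 + a = t + a - 1 by ring]
  rfl

theorem bMinus_translate (t a : ℤ) (ω : Path 𝒳 𝒴 𝒲) :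
    M.bMinus t (translate a ω) = M.bMinus (t + a) ω := by
  simp only [bMinus, Ybar_translate, show t - 1 + a = t + a - 1 by ring]
  rfl

theorem mixing_translate (r : ℝ) (t a : ℤ) (ω : Path 𝒳 𝒴 𝒲) :
    M.mixing p r t (translate a ω) = M.mixing p r (t + a) ω := by
  simp only [mixing, bPlus_translate, bMinus_translate, sub_add_eq_add_sub]

theorem bPlus_eq_translate (t : ℤ) (ω : Path 𝒳 𝒴 𝒲) :
    M.bPlus t ω = M.bPlus 1 (translate (t - 1) ω) := by
  rw [bPlus_translate, add_sub_cancel]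

theorem bMinus_eq_translate (t : ℤ) (ω : Path 𝒳 𝒴 𝒲) :
    M.bMinus t ω = M.bMinus 1 (translate (t - 1) ω) := by
  rw [bMinus_translate, add_sub_cancel]

variable [Nonempty Θ] [Nonempty 𝒳]

theorem bPlus_pos (hg : M.EmissionBounds) (ω : Path 𝒳 𝒴 𝒲) (t : ℤ) : 0 < M.bPlus t ω :=
  (hg.bMinus_pos ω t).trans_le (hg.bMinus_le_bPlus ω t)

/-- A supremum over uncountably many parameters and states need not be measurable. At time 1
measurability is recovered by exponentiating the integrable `log b_+`, at other times by
stationarity. -/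
theorem aemeasurable_bPlus (hst : MeasurePreserving shift (M.P θs) (M.P θs))
    (hg : M.EmissionBounds) (hlog : M.LogIntegrable θs) (t : ℤ) :
    AEMeasurable (M.bPlus t) (M.P θs) := by
  have h1 : AEMeasurable (M.bPlus 1) (M.P θs) :=
    hlog.1.aemeasurable.exp.congr (ae_of_all _ fun ω => Real.exp_log (bPlus_pos hg ω 1))
  rw [funext (bPlus_eq_translate t)]
  exact h1.comp_quasiMeasurePreserving
    (measurePreserving_translate hst (t - 1)).quasiMeasurePreserving

theorem aemeasurable_bMinus (hst : MeasurePreserving shift (M.P θs) (M.P θs))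
    (hg : M.EmissionBounds) (hlog : M.LogIntegrable θs) (t : ℤ) :
    AEMeasurable (M.bMinus t) (M.P θs) := by
  have h1 : AEMeasurable (M.bMinus 1) (M.P θs) :=
    hlog.2.aemeasurable.exp.congr (ae_of_all _ fun ω => Real.exp_log (hg.bMinus_pos ω 1))
  rw [funext (bMinus_eq_translate t)]
  exact h1.comp_quasiMeasurePreserving
    (measurePreserving_translate hst (t - 1)).quasiMeasurePreserving

theorem aemeasurable_mixing (hst : MeasurePreserving shift (M.P θs) (M.P θs))
    (hg : M.EmissionBounds) (hlog : M.LogIntegrable θs) (r : ℝ) (t : ℤ) :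
    AEMeasurable (M.mixing p r t) (M.P θs) :=
  (Finset.aemeasurable_fun_prod (Finset.range p)
    (f := fun (i : ℕ) ω => M.bMinus (t - (i : ℤ)) ω / M.bPlus (t - (i : ℤ)) ω) fun i _ =>
    (aemeasurable_bMinus hst hg hlog (t - (i : ℤ))).div
      (aemeasurable_bPlus hst hg hlog (t - (i : ℤ)))).const_mul r

theorem mixing_pos (hg : M.EmissionBounds) {r : ℝ} (hr : 0 < r) (t : ℤ) (ω : Path 𝒳 𝒴 𝒲) :
    0 < M.mixing p r t ω :=
  mul_pos hr (Finset.prod_pos fun _ _ => div_pos (hg.bMinus_pos ω _) (bPlus_pos hg ω _))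

theorem mixing_le_one (hg : M.EmissionBounds) {r : ℝ} (hr1 : r ≤ 1) (t : ℤ)
    (ω : Path 𝒳 𝒴 𝒲) : M.mixing p r t ω ≤ 1 :=
  mul_le_one₀ hr1
    (Finset.prod_nonneg fun _ _ => (div_pos (hg.bMinus_pos ω _) (bPlus_pos hg ω _)).le)
    (Finset.prod_le_one (fun _ _ => (div_pos (hg.bMinus_pos ω _) (bPlus_pos hg ω _)).le)
      fun _ _ => (div_le_one (bPlus_pos hg ω _)).2 (hg.bMinus_le_bPlus ω _))

theorem integrable_mixing (hst : MeasurePreserving shift (M.P θs) (M.P θs))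
    (hg : M.EmissionBounds) (hlog : M.LogIntegrable θs) {r : ℝ} (hr : 0 < r) (hr1 : r ≤ 1)
    (t : ℤ) : Integrable (M.mixing p r t) (M.P θs) :=
  Integrable.of_bound (aemeasurable_mixing hst hg hlog r t).aestronglyMeasurable 1
    (ae_of_all _ fun ω => by
      rw [Real.norm_eq_abs, abs_of_pos (mixing_pos hg hr t ω)]
      exact mixing_le_one hg hr1 t ω)

/-- The mixing accumulated over the future and over the past grows linearly. -/
theorem exists_linear_mixing (herg : Ergodic shift (M.P θs)) (hg : M.EmissionBounds)
    (hlog : M.LogIntegrable θs) {r : ℝ} (hr : 0 < r) (hr1 : r ≤ 1) :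
    ∃ c : ℝ, 0 < c ∧ ∀ᵐ ω ∂(M.P θs), ∃ C : ℝ, ∀ k m : ℕ,
      c * (k + m) - C ≤ ∑ i ∈ Finset.range k, M.mixing p r i ω +
        ∑ i ∈ Finset.range m, M.mixing p r (-1 - i) ω := by
  have hst := herg.toMeasurePreserving
  have hi := fun t => integrable_mixing (p := p) hst hg hlog hr hr1 t
  have hpos : 0 < ∫ ω, M.mixing p r 0 ω ∂(M.P θs) := by
    refine (integral_pos_iff_support_of_nonneg (fun ω => (mixing_pos hg hr 0 ω).le) (hi 0)).2 ?_
    rw [Function.support_eq_univ fun ω => (mixing_pos hg hr 0 ω).ne']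
    simp
  have heq : ∫ ω, M.mixing p r (-1) ω ∂(M.P θs) = ∫ ω, M.mixing p r 0 ω ∂(M.P θs) := by
    have h := (measurePreserving_translate hst (-1)).integral_comp' (M.mixing p r 0)
    simpa only [mixing_translate, zero_add] using h
  -- Any rate strictly below the mean would do. Splitting at time 0 leaves two one-parameter sums,
  -- so the random constant depends on neither `k` nor `m`.
  refine ⟨(∫ ω, M.mixing p r 0 ω ∂(M.P θs)) / 2, by positivity, ?_⟩
  filter_upwards [ae_linear_lower_bound_birkhoffSum herg (hi 0) (half_lt_self hpos),
    ae_linear_lower_bound_birkhoffSum (ergodic_translate_neg_one herg) (hi (-1))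
      (by rw [heq]; exact half_lt_self hpos)] with ω ⟨C, hC⟩ ⟨C', hC'⟩
  refine ⟨C + C', fun k m => ?_⟩
  have h1 := hC k
  have h2 := hC' m
  rw [← coe_translate_one] at h1
  simp only [iterate_translate, mixing_translate, mul_one, zero_add] at h1
  simp only [iterate_translate, mixing_translate, mul_neg, mul_one, ← sub_eq_add_neg] at h2
  linarith

/-- The emission ratios grow subexponentially. -/
theorem ae_ratio_le_exp (hst : MeasurePreserving shift (M.P θs) (M.P θs)) (hg : M.EmissionBounds)
    (hlog : M.LogIntegrable θs) (htail : M.RatioTail θs) {γ : ℝ} (hγ : 0 < γ) :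
    ∀ᵐ ω ∂(M.P θs), ∃ C : ℝ, ∀ k : ℕ, 1 ≤ k →
      M.bPlus k ω / M.bMinus k ω ≤ C * Real.exp (γ * k) := by
  obtain ⟨α, C₁, C₂, β, hα, hC₁, hC₂, hβ, ht⟩ := htail
  -- The tail condition at `r = γ k / α`, with `k = n + 1`, has threshold `C₁ e^{γ k}` and
  -- probability of order `k^{-β}`, summable since `β > 1`.
  set S : ℕ → Set (Path 𝒳 𝒴 𝒲) := fun n =>
    {ω | C₁ * Real.exp (α * (γ / α * (n + 1 : ℕ))) ≤
      M.bPlus (n + 1 : ℕ) ω / M.bMinus (n + 1 : ℕ) ω} with hS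
  have hbound : ∀ n, M.P θs (S n) ≤
      ENNReal.ofReal (C₂ * (γ / α) ^ (-β) * ((n + 1 : ℕ) : ℝ) ^ (-β)) := by
    intro n
    have hpre : S n = translate (((n + 1 : ℕ) : ℤ) - 1) ⁻¹'
        {ω | C₁ * Real.exp (α * (γ / α * (n + 1 : ℕ))) ≤ M.bPlus 1 ω / M.bMinus 1 ω} := by
      ext ω
      simp only [hS, Set.mem_preimage, Set.mem_ofPred_eq]
      rw [bPlus_eq_translate, bMinus_eq_translate]
    rw [hpre, (measurePreserving_translate hst _).measure_preimage]
    · refine (ht (γ / α * (n + 1 : ℕ)) (by positivity)).trans_eq ?_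
      rw [Real.mul_rpow (by positivity) (by positivity), mul_assoc]
    · exact nullMeasurableSet_le aemeasurable_const
        ((aemeasurable_bPlus hst hg hlog 1).div (aemeasurable_bMinus hst hg hlog 1))
  have hsum : Summable fun n : ℕ => C₂ * (γ / α) ^ (-β) * ((n + 1 : ℕ) : ℝ) ^ (-β) :=
    ((summable_nat_add_iff 1).2 (Real.summable_nat_rpow.2 (by linarith))).mul_left _
  have hfin : (∑' n, M.P θs (S n)) ≠ ⊤ :=
    ne_top_of_le_ne_top hsum.tsum_ofReal_ne_top (ENNReal.tsum_le_tsum hbound)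
  filter_upwards [ae_eventually_notMem hfin] with ω hω
  obtain ⟨N, hN⟩ := eventually_atTop.1 hω
  have hR : ∀ n : ℕ, 0 ≤ M.bPlus (n + 1 : ℕ) ω / M.bMinus (n + 1 : ℕ) ω := fun n =>
    (div_pos (bPlus_pos hg ω _) (hg.bMinus_pos ω _)).le
  -- The sum pays for the finitely many times before the Borel–Cantelli bound sets in.
  refine ⟨C₁ + ∑ n ∈ Finset.range N, M.bPlus (n + 1 : ℕ) ω / M.bMinus (n + 1 : ℕ) ω,
    fun k hk => ?_⟩
  obtain ⟨n, rfl⟩ := Nat.exists_eq_add_of_le' hk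
  have hsum0 : 0 ≤ ∑ n ∈ Finset.range N, M.bPlus (n + 1 : ℕ) ω / M.bMinus (n + 1 : ℕ) ω :=
    Finset.sum_nonneg fun n _ => hR n
  rw [add_mul]
  rcases lt_or_ge n N with hn | hn
  · have h1 : 1 ≤ Real.exp (γ * (n + 1 : ℕ)) := Real.one_le_exp (by positivity)
    have h2 := Finset.single_le_sum (fun n _ => hR n) (Finset.mem_range.2 hn)
    have h3 := le_mul_of_one_le_right hsum0 h1
    have h4 : 0 ≤ C₁ * Real.exp (γ * (n + 1 : ℕ)) := by positivity
    linarith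
  · have h1 := hN n hn
    simp only [hS, Set.mem_ofPred_eq, not_le] at h1
    rw [show α * (γ / α * (n + 1 : ℕ)) = γ * (n + 1 : ℕ) by field_simp] at h1
    have h2 := mul_nonneg hsum0 (Real.exp_pos (γ * (n + 1 : ℕ))).le
    linarith

omit [Nonempty Θ] [Nonempty 𝒳] in
/-- Rearrangement of the mixing between times `-m + 1` and `k - 1` around time `0`. -/
theorem sum_mixing_rearrange {e : ℤ → ℝ} (he : ∀ t, e t ≤ 1) {k : ℕ} (hk : 1 ≤ k) (m : ℕ) :
    ∑ i ∈ Finset.range k, e i + ∑ i ∈ Finset.range m, e (-1 - i) - 1 ≤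
      ∑ j ∈ Finset.range (m + k - 1), e ((k : ℤ) - 1 - j) := by
  -- The two sums around 0 have one term more, that of time `-m`; it costs the 1.
  have h1 : ∑ j ∈ Finset.range (m + k - 1), e ((k : ℤ) - 1 - j) + e ((k : ℤ) - 1 - (m + k - 1 : ℕ))
      = ∑ j ∈ Finset.range (k + m), e ((k : ℤ) - 1 - j) := by
    rw [← Finset.sum_range_succ, show m + k - 1 + 1 = k + m by omega]
  have h2 : ∑ j ∈ Finset.range k, e ((k : ℤ) - 1 - j) = ∑ i ∈ Finset.range k, e i := by
    rw [← Finset.sum_range_reflect]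
    refine Finset.sum_congr rfl fun j hj => ?_
    have := Finset.mem_range.1 hj
    congr 1
    omega
  have h3 : ∑ j ∈ Finset.range m, e ((k : ℤ) - 1 - (k + j : ℕ)) =
      ∑ i ∈ Finset.range m, e (-1 - i) := by
    refine Finset.sum_congr rfl fun j _ => ?_
    congr 1
    omega
  rw [Finset.sum_range_add, h2, h3] at h1
  have := he ((k : ℤ) - 1 - (m + k - 1 : ℕ))
  linarith

omit [Nonempty Θ] [Nonempty 𝒳] in
theorem abs_log_sub_log_le {b y z : ℝ} (hb : 0 < b) (hy : b ≤ y) (hz : b ≤ z) :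
    |Real.log y - Real.log z| ≤ |y - z| / b := by
  have key : ∀ y z : ℝ, b ≤ y → b ≤ z → Real.log y - Real.log z ≤ |y - z| / b := by
    intro y z hy hz
    have hy0 := hb.trans_le hy
    have hz0 := hb.trans_le hz
    rw [← Real.log_div hy0.ne' hz0.ne']
    calc Real.log (y / z) ≤ y / z - 1 := Real.log_le_sub_one_of_pos (by positivity)
      _ = (y - z) / z := by field_simp
      _ ≤ |y - z| / z := by gcongr; exact le_abs_self _
      _ ≤ |y - z| / b := by gcongr
  rw [abs_le]
  have h1 := key y z hy hz
  have h2 := key z y hz hy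
  rw [abs_sub_comm z y] at h2
  constructor <;> linarith

/-! ### The forgetting bound and its exceptional pairs. -/

/-- The random factor in front of the geometric term. -/
noncomputable def forgettingConst (M : Model Θ 𝒳 𝒴 𝒲 s) (p : ℕ) (r c : ℝ) (k m : ℕ)
    (ω : Path 𝒳 𝒴 𝒲) : ℝ :=
  M.bPlus k ω / M.bMinus k ω * Real.exp ((p + 1 - (∑ i ∈ Finset.range k, M.mixing p r i ω +
    ∑ i ∈ Finset.range m, M.mixing p r (-1 - i) ω)) / p) / Real.exp (-c) ^ ((k + m) / (3 * p))

theorem aemeasurable_forgettingConst (hst : MeasurePreserving shift (M.P θs) (M.P θs))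
    (hg : M.EmissionBounds) (hlog : M.LogIntegrable θs) (r c : ℝ) (k m : ℕ) :
    AEMeasurable (M.forgettingConst p r c k m) (M.P θs) := by
  have hs1 := Finset.aemeasurable_fun_sum (Finset.range k) fun (i : ℕ) _ =>
    aemeasurable_mixing (p := p) hst hg hlog r i
  have hs2 := Finset.aemeasurable_fun_sum (Finset.range m) fun (i : ℕ) _ =>
    aemeasurable_mixing (p := p) hst hg hlog r (-1 - i)
  exact ((((aemeasurable_bPlus hst hg hlog k).div (aemeasurable_bMinus hst hg hlog k)).mul
    (((hs1.add hs2).const_sub _).div_const _).exp).div_const _)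

/-- The power of `exp (-c)` cancels against the definition of `forgettingConst`, so `c` is still
free here. The bound concerns arbitrary points of the interval because it is also applied to
averages of densities. -/
theorem abs_log_condDensity_sub_le (hq : M.TransitionDensities p) (hg : M.EmissionBounds) :
    ∃ r : ℝ, 0 < r ∧ r ≤ 1 ∧ ∀ (c : ℝ) (θ : Θ) (ω : Path 𝒳 𝒴 𝒲) (k m : ℕ), 1 ≤ k →
      ∃ a b : ℝ, (∀ m', m ≤ m' → ∀ x, M.condDensity k m' x θ ω ∈ Set.Icc a b) ∧
        ∀ y z, y ∈ Set.Icc a b → z ∈ Set.Icc a b → M.bMinus k ω ≤ y → M.bMinus k ω ≤ z →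
          |Real.log y - Real.log z| ≤
            M.forgettingConst p r c k m ω * Real.exp (-c) ^ ((k + m) / (3 * p)) := by
  obtain ⟨r, hr, hr1, h⟩ := exists_Icc_condDensity hq hg
  refine ⟨r, hr, hr1, fun c θ ω k m hk => ?_⟩
  obtain ⟨a, b, h1, h2, h3⟩ := h θ ω k m hk
  refine ⟨a, b, h1, fun y z hy hz hby hbz => ?_⟩
  have hp : (0 : ℝ) < p := by exact_mod_cast hq.pos_steps
  have hbm := hg.bMinus_pos ω k
  have hbp := bPlus_pos hg ω k
  set T := ∑ i ∈ Finset.range k, M.mixing p r i ω +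
    ∑ i ∈ Finset.range m, M.mixing p r (-1 - i) ω with hT
  have hsum := sum_mixing_rearrange (e := fun t => M.mixing p r t ω)
    (fun t => mixing_le_one hg hr1 t ω) hk m
  -- A `p`-th root is taken; the 1 comes from the rearrangement of the sum.
  have hba : b - a ≤ Real.exp ((p + 1 - T) / p) * M.bPlus k ω := by
    refine le_of_pow_le_pow_left₀ (Nat.one_le_iff_ne_zero.1 hq.pos_steps) (by positivity) ?_
    refine h3.trans ?_
    rw [mul_pow, ← Real.exp_nat_mul, mul_div_cancel₀ _ hp.ne']
    refine mul_le_mul_of_nonneg_right (Real.exp_le_exp.2 ?_) (by positivity)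
    linarith
  rw [forgettingConst, div_mul_cancel₀ _ (pow_pos (Real.exp_pos _) _).ne']
  refine (abs_log_sub_log_le hbm hby hbz).trans ?_
  rw [div_mul_eq_mul_div]
  refine div_le_div_of_nonneg_right ?_ hbm.le
  calc |y - z| ≤ b - a := abs_sub_le_of_le_of_le hy.1 hy.2 hz.1 hz.2
    _ ≤ _ := by rw [mul_comm]; exact hba

/-- In units of `c (k + m) / (3 p)`, mixing gains three. At most one is spent on the growth of `b_+
/ b_-`, with exponent `c / (3 p)`, and one on division by the geometric term; the last makes the
factor tend to 0. Hence the 3 in the rate. -/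
theorem finite_forgettingConst (hq : M.TransitionDensities p) (herg : Ergodic shift (M.P θs))
    (hg : M.EmissionBounds) (hlog : M.LogIntegrable θs) (htail : M.RatioTail θs) {r : ℝ}
    (hr : 0 < r) (hr1 : r ≤ 1) : ∃ c : ℝ, 0 < c ∧ ∀ᵐ ω ∂(M.P θs),
      {a : ℕ × ℕ | 1 ≤ a.1 ∧ 1 ≤ M.forgettingConst p r c a.1 a.2 ω}.Finite := by
  obtain ⟨c, hc, hmix⟩ := exists_linear_mixing (p := p) herg hg hlog hr hr1
  refine ⟨c, hc, ?_⟩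
  have hp : (0 : ℝ) < p := by exact_mod_cast hq.pos_steps
  filter_upwards [hmix, ae_ratio_le_exp herg.toMeasurePreserving hg hlog htail
    (show 0 < c / (3 * p) by positivity)] with ω ⟨C, hC⟩ ⟨C', hC'⟩
  have hlim : Tendsto (fun n : ℕ => C' * Real.exp ((p + 1 + C) / p) *
      Real.exp (-(c / (3 * p) * n))) atTop (𝓝 0) := by
    rw [← mul_zero (C' * Real.exp ((p + 1 + C) / p))]
    refine Tendsto.const_mul _ (Real.tendsto_exp_neg_atTop_nhds_zero.comp ?_)
    exact tendsto_natCast_atTop_atTop.const_mul_atTop (by positivity)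
  obtain ⟨N, hN⟩ := eventually_atTop.1 (hlim.eventually_lt_const zero_lt_one)
  refine ((Finset.range N) ×ˢ (Finset.range N)).finite_toSet.subset fun ⟨k, m⟩ ⟨hk, hA⟩ => ?_
  simp only at hk hA
  have hlt : k + m < N := by
    by_contra! hcon
    refine absurd (hN (k + m) hcon) (not_lt.2 (hA.trans ?_))
    have hkm := hC k m
    have hR := hC' k hk
    have hR0 : 0 ≤ M.bPlus k ω / M.bMinus k ω :=
      (div_pos (bPlus_pos hg ω _) (hg.bMinus_pos ω _)).le
    have hfl : (((k + m) / (3 * p) : ℕ) : ℝ) ≤ (k + m) / (3 * p) := by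
      have := Nat.cast_div_le (α := ℝ) (m := k + m) (n := 3 * p)
      push_cast at this
      exact this
    unfold forgettingConst
    set T := ∑ i ∈ Finset.range k, M.mixing p r i ω +
      ∑ i ∈ Finset.range m, M.mixing p r (-1 - i) ω
    have hC'0 : 0 ≤ C' := by
      by_contra! hneg
      exact absurd (hR0.trans hR) (not_le.2 (mul_neg_of_neg_of_pos hneg (Real.exp_pos _)))
    rw [← Real.exp_nat_mul, div_eq_mul_inv, ← Real.exp_neg]
    calc M.bPlus k ω / M.bMinus k ω * Real.exp ((p + 1 - T) / p) *
          Real.exp (-(((k + m) / (3 * p) : ℕ) * -c))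
        ≤ C' * Real.exp (c / (3 * p) * k) * Real.exp ((p + 1 - T) / p) *
          Real.exp (-(((k + m) / (3 * p) : ℕ) * -c)) := by gcongr
      _ = C' * Real.exp (c / (3 * p) * k + (p + 1 - T) / p +
          ((k + m) / (3 * p) : ℕ) * c) := by
          rw [Real.exp_add, Real.exp_add, mul_neg, neg_neg]; ring
      _ ≤ C' * Real.exp ((p + 1 + C) / p + -(c / (3 * p) * (k + m : ℕ))) := by
          refine mul_le_mul_of_nonneg_left (Real.exp_le_exp.2 ?_) hC'0
          have h1 : (p + 1 - T) / p ≤ (p + 1 + C) / p - c * (k + m) / p := by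
            rw [← sub_div]
            refine div_le_div_of_nonneg_right ?_ hp.le
            linarith
          have h2 : (((k + m) / (3 * p) : ℕ) : ℝ) * c ≤ (k + m) / (3 * p) * c := by gcongr
          have h3 : c / (3 * p) * k ≤ c / (3 * p) * (k + m) := by
            gcongr
            linarith [Nat.cast_nonneg (α := ℝ) m]
          have h4 : c * (k + m) / p = 3 * (c / (3 * p) * (k + m)) := by field_simp
          have h5 : ((k : ℝ) + m) / (3 * p) * c = c / (3 * p) * (k + m) := by field_simp
          push_cast
          linarith
      _ = _ := by rw [Real.exp_add, mul_assoc]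
  simp only [Finset.coe_product, Set.mem_prod, Finset.mem_coe, Finset.mem_range]
  omega

/-! ### Passage to the limit and conclusion. -/

omit [Nonempty Θ] [Nonempty 𝒳] in
-- The point `y` need not belong to the sequence `f`: it will come from another initial state.
theorem abs_sub_limUnder_le {f b : ℕ → ℝ} {N : ℕ} (hb : Tendsto b atTop (𝓝 0))
    (h : ∀ m, N ≤ m → ∀ m', m ≤ m' → |f m - f m'| ≤ b m) {y B : ℝ} {n : ℕ}
    (hy : ∀ m, n ≤ m → |y - f m| ≤ B) : |y - limUnder atTop f| ≤ B := by
  have hcs : CauchySeq f := by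
    refine Metric.cauchySeq_iff'.2 fun ε hε => ?_
    obtain ⟨m, hm1, hm2⟩ := ((hb.eventually_lt_const hε).and (eventually_ge_atTop N)).exists
    refine ⟨m, fun m' hm' => ?_⟩
    rw [Real.dist_eq, abs_sub_comm]
    exact (h m hm2 m' hm').trans_lt hm1
  have hlim := hcs.tendsto_limUnder
  refine le_of_tendsto (tendsto_const_nhds.sub hlim).abs ?_
  filter_upwards [eventually_ge_atTop n] with m hm using hy m hm

omit [Nonempty Θ] [Nonempty 𝒳] in
theorem abs_le_abs_add_abs_of_mem_Icc {a b y : ℝ} (h : y ∈ Set.Icc a b) : |y| ≤ |b| + |a| := by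
  rw [abs_le]
  obtain ⟨h1, h2⟩ := h
  constructor
  · linarith [neg_abs_le a, abs_nonneg b]
  · linarith [le_abs_self b, abs_nonneg a]

omit [Nonempty Θ] in
/-- Uniform forgetting of the initial state, for a model on arbitrary measurable spaces. -/
theorem uniform_forgetting (hq : M.TransitionDensities p) (herg : Ergodic shift (M.P θs))
    (hg : M.EmissionBounds) (hlog : M.LogIntegrable θs) (htail : M.RatioTail θs)
    (κ : Θ → (k m : ℕ) → Kernel (Obs s 𝒴 𝒲 k m) 𝒳) (hκ : ∀ θ k m, IsMarkovKernel (κ θ k m)) :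
    ∃ (ρ K : ℝ) (A : ℕ → ℕ → Path 𝒳 𝒴 𝒲 → ℝ) (B : ℕ → Path 𝒳 𝒴 𝒲 → ℝ)
      (Δlim : ℕ → Θ → Path 𝒳 𝒴 𝒲 → ℝ),
      0 < ρ ∧ ρ < 1 ∧
      (∀ k m, Measurable (A k m)) ∧
      (∀ᵐ ω ∂(M.P θs), ∀ k m m' : ℕ, 1 ≤ k → m ≤ m' → ∀ (x x' : 𝒳) (θ : Θ),
        |M.DeltaX k m x θ ω - M.DeltaX k m' x' θ ω| ≤ A k m ω * ρ ^ ((k + m) / (3 * p))) ∧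
      (∀ᵐ ω ∂(M.P θs), ∀ k m : ℕ, 1 ≤ k → ∀ (x : 𝒳) (θ : Θ),
        |M.DeltaX k m x θ ω - M.Delta κ k m θ ω| ≤ A k m ω * ρ ^ ((k + m) / (3 * p))) ∧
      (∀ᵐ ω ∂(M.P θs), ∀ k m m' : ℕ, 1 ≤ k → ∀ (x : 𝒳) (θ θ' : Θ),
        |M.DeltaX k m x θ ω| + |M.Delta κ k m' θ' ω| ≤ B k ω) ∧
      (∀ᵐ ω ∂(M.P θs), {a : ℕ × ℕ | 1 ≤ a.1 ∧ K ≤ A a.1 a.2 ω}.Finite) ∧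
      (∀ k, 1 ≤ k → Integrable (B k) (M.P θs)) ∧
      (∀ᵐ ω ∂(M.P θs), ∀ k : ℕ, 1 ≤ k →
        (∀ x : 𝒳, TendstoUniformly (fun m θ => M.DeltaX k m x θ ω) (fun θ => Δlim k θ ω)
          atTop) ∧
        TendstoUniformly (fun m θ => M.Delta κ k m θ ω) (fun θ => Δlim k θ ω) atTop) := by
  have : Nonempty Θ := ⟨θs⟩
  have hst := herg.toMeasurePreserving
  obtain ⟨r, hr, hr1, hdiff⟩ := abs_log_condDensity_sub_le hq hg
  obtain ⟨c, hc, hfin⟩ := finite_forgettingConst hq herg hg hlog htail hr hr1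
  have hAm := fun k m => aemeasurable_forgettingConst (p := p) hst hg hlog r c k m
  -- Measurable versions, which agree with the original factors off one null set for all the
  -- countably many pairs.
  set A : ℕ → ℕ → Path 𝒳 𝒴 𝒲 → ℝ := fun k m => (hAm k m).mk _ with hA
  have hAeq : ∀ᵐ ω ∂(M.P θs), ∀ k m, M.forgettingConst p r c k m ω = A k m ω :=
    ae_all_iff.2 fun k => ae_all_iff.2 fun m => (hAm k m).ae_eq_mk
  have hmean : ∀ (k m : ℕ) (θ : Θ) (ω : Path 𝒳 𝒴 𝒲), 1 ≤ k → ∀ a b : ℝ,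
      (∀ x, M.condDensity k m x θ ω ∈ Set.Icc a b) →
      ∫ x, M.condDensity k m x θ ω ∂(κ θ k m (obs s k m ω)) ∈ Set.Icc a b :=
    fun k m θ ω hk a b h =>
      haveI := hκ θ k m
      integral_condDensity_mem_Icc hq hg θ ω hk m _ h
  have hlogmem : ∀ (k : ℕ) (ω : Path 𝒳 𝒴 𝒲) (y : ℝ), y ∈ Set.Icc (M.bMinus k ω) (M.bPlus k ω) →
      |Real.log y| ≤ |Real.log (M.bPlus k ω)| + |Real.log (M.bMinus k ω)| :=
    fun k ω y hy => abs_le_abs_add_abs_of_mem_Icc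
      ⟨Real.log_le_log (hg.bMinus_pos ω k) hy.1,
        Real.log_le_log ((hg.bMinus_pos ω k).trans_le hy.1) hy.2⟩
  have ha : ∀ᵐ ω ∂(M.P θs), ∀ k m m' : ℕ, 1 ≤ k → m ≤ m' → ∀ (x x' : 𝒳) (θ : Θ),
      |M.DeltaX k m x θ ω - M.DeltaX k m' x' θ ω| ≤
        A k m ω * Real.exp (-c) ^ ((k + m) / (3 * p)) := by
    filter_upwards [hAeq] with ω hω k m m' hk hm x x' θ
    obtain ⟨a, b, h1, h2⟩ := hdiff c θ ω k m hk
    rw [← hω]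
    exact h2 _ _ (h1 m le_rfl x) (h1 m' hm x') (condDensity_mem_Icc hq hg θ ω hk m x).1
      (condDensity_mem_Icc hq hg θ ω hk m' x').1
  have hb : ∀ᵐ ω ∂(M.P θs), ∀ k m : ℕ, 1 ≤ k → ∀ (x : 𝒳) (θ : Θ),
      |M.DeltaX k m x θ ω - M.Delta κ k m θ ω| ≤
        A k m ω * Real.exp (-c) ^ ((k + m) / (3 * p)) := by
    filter_upwards [hAeq] with ω hω k m hk x θ
    obtain ⟨a, b, h1, h2⟩ := hdiff c θ ω k m hk
    rw [← hω]
    exact h2 _ _ (h1 m le_rfl x) (hmean k m θ ω hk a b (h1 m le_rfl))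
      (condDensity_mem_Icc hq hg θ ω hk m x).1
      (hmean k m θ ω hk _ _ (condDensity_mem_Icc hq hg θ ω hk m)).1
  have hfinA : ∀ᵐ ω ∂(M.P θs), {a : ℕ × ℕ | 1 ≤ a.1 ∧ 1 ≤ A a.1 a.2 ω}.Finite := by
    filter_upwards [hAeq, hfin] with ω hω h
    simpa only [hω] using h
  have hρ1 : Real.exp (-c) < 1 := Real.exp_lt_one_iff.2 (by linarith)
  refine ⟨Real.exp (-c), 1, A,
    fun k ω => 2 * (|Real.log (M.bPlus k ω)| + |Real.log (M.bMinus k ω)|),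
    -- One fixed initial state defines the limit; (a) compares every other state with it.
    fun k θ ω => limUnder atTop fun m => M.DeltaX k m (Classical.arbitrary 𝒳) θ ω,
    Real.exp_pos _, hρ1, fun k m => (hAm k m).measurable_mk, ha, hb, ?_, hfinA, ?_, ?_⟩
  · refine ae_of_all _ fun ω k m m' hk x θ θ' => ?_
    simp only [two_mul]
    exact add_le_add (hlogmem k ω _ (condDensity_mem_Icc hq hg θ ω hk m x))
      (hlogmem k ω _ (hmean k m' θ' ω hk _ _ (condDensity_mem_Icc hq hg θ' ω hk m')))
  · intro k _
    have ht := measurePreserving_translate hst ((k : ℤ) - 1)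
    refine Integrable.const_mul ?_ 2
    have h1 := (ht.integrable_comp_of_integrable hlog.1).abs
    have h2 := (ht.integrable_comp_of_integrable hlog.2).abs
    simp only [Function.comp_apply, ← bPlus_eq_translate] at h1
    simp only [Function.comp_apply, ← bMinus_eq_translate] at h2
    exact h1.add h2
  · filter_upwards [ha, hb, hfinA] with ω ha hb hfin k hk
    set x₀ := Classical.arbitrary 𝒳
    set b : ℕ → ℝ := fun m => Real.exp (-c) ^ ((k + m) / (3 * p)) with hbdef
    have hp : 0 < 3 * p := by have := hq.pos_steps; omega
    have hb0 : Tendsto b atTop (𝓝 0) :=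
      (tendsto_pow_atTop_nhds_zero_of_lt_one (Real.exp_pos _).le hρ1).comp
        ((Nat.tendsto_div_const_atTop hp.ne').comp
          (tendsto_atTop_mono (fun m => Nat.le_add_left m k) tendsto_id))
    -- For fixed `k` only finitely many `m` are exceptional; beyond them the bound is purely
    -- geometric and free of `θ`.
    obtain ⟨N, hN⟩ : ∃ N, ∀ m, N ≤ m → A k m ω < 1 := by
      obtain ⟨N, hN⟩ := (hfin.image Prod.snd).bddAbove
      refine ⟨N + 1, fun m hm => ?_⟩
      by_contra! hcon
      have := hN ⟨(k, m), ⟨hk, hcon⟩, rfl⟩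
      simp only at this
      omega
    have hAb : ∀ m, N ≤ m → A k m ω * Real.exp (-c) ^ ((k + m) / (3 * p)) ≤ b m := fun m hm =>
      mul_le_of_le_one_left (pow_pos (Real.exp_pos _) _).le (hN m hm).le
    have hlim : ∀ x θ m, N ≤ m →
        |M.DeltaX k m x θ ω - limUnder atTop fun m => M.DeltaX k m x₀ θ ω| ≤ b m :=
      fun x θ m hm => abs_sub_limUnder_le hb0
        (fun m hm m' hm' => (ha k m m' hk hm' x₀ x₀ θ).trans (hAb m hm))
        (fun m' hm' => (ha k m m' hk hm' x x₀ θ).trans (hAb m hm))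
    constructor
    · intro x
      refine Metric.tendstoUniformly_iff.2 fun ε hε => ?_
      filter_upwards [hb0.eventually_lt_const hε, eventually_ge_atTop N] with m hm1 hm2 θ
      rw [dist_comm, Real.dist_eq]
      exact (hlim x θ m hm2).trans_lt hm1
    · refine Metric.tendstoUniformly_iff.2 fun ε hε => ?_
      filter_upwards [hb0.eventually_lt_const (half_pos hε), eventually_ge_atTop N]
        with m hm1 hm2 θ
      rw [Real.dist_eq]
      have h1 := hlim x₀ θ m hm2
      have h2 := (hb k m hk x₀ θ).trans (hAb m hm2)
      rw [abs_le] at h1 h2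
      rw [abs_lt]
      constructor <;> linarith

end Model
end RegimeSwitching

open RegimeSwitching in
theorem lemma3 {d dx dy dw s p : ℕ}
    (Θ : Set (EuclideanSpace ℝ (Fin d))) (𝒳 : Set (EuclideanSpace ℝ (Fin dx)))
    (𝒴 : Set (EuclideanSpace ℝ (Fin dy))) (𝒲 : Set (EuclideanSpace ℝ (Fin dw)))
    (hΘ : IsCompact Θ) (h𝒳 : IsCompact 𝒳)
    (θs : Θ) (hθs : (θs : EuclideanSpace ℝ (Fin d)) ∈ interior Θ)
    (M : Model Θ 𝒳 𝒴 𝒲 s)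
    (hq : M.TransitionDensities p) (hM : M.IsRegimeSwitching) (herg : Ergodic shift (M.P θs))
    (hg : M.EmissionBounds) (hlog : M.LogIntegrable θs) (htail : M.RatioTail θs)
    (κ : Θ → (k m : ℕ) → ProbabilityTheory.Kernel (Obs s 𝒴 𝒲 k m) 𝒳) (hκ : M.IsInitialLaw κ) :
    ∃ (ρ K : ℝ) (A : ℕ → ℕ → Path 𝒳 𝒴 𝒲 → ℝ) (B : ℕ → Path 𝒳 𝒴 𝒲 → ℝ)
      (Δlim : ℕ → Θ → Path 𝒳 𝒴 𝒲 → ℝ),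
      0 < ρ ∧ ρ < 1 ∧
      (∀ k m, Measurable (A k m)) ∧
      -- (a)
      (∀ᵐ ω ∂(M.P θs), ∀ k m m' : ℕ, 1 ≤ k → m ≤ m' → ∀ (x x' : 𝒳) (θ : Θ),
        |M.DeltaX k m x θ ω - M.DeltaX k m' x' θ ω| ≤ A k m ω * ρ ^ ((k + m) / (3 * p))) ∧
      -- (b)
      (∀ᵐ ω ∂(M.P θs), ∀ k m : ℕ, 1 ≤ k → ∀ (x : 𝒳) (θ : Θ),
        |M.DeltaX k m x θ ω - M.Delta κ k m θ ω| ≤ A k m ω * ρ ^ ((k + m) / (3 * p))) ∧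
      -- (c): the sum of the two suprema, each taken separately, is at most `B k`
      (∀ᵐ ω ∂(M.P θs), ∀ k m m' : ℕ, 1 ≤ k → ∀ (x : 𝒳) (θ θ' : Θ),
        |M.DeltaX k m x θ ω| + |M.Delta κ k m' θ' ω| ≤ B k ω) ∧
      -- `P_{θ*}(A_{k,m} ≥ K i.o.) = 0`, over the pairs `(k, m)` with `k ≥ 1`, `m ≥ 0`
      (∀ᵐ ω ∂(M.P θs), {a : ℕ × ℕ | 1 ≤ a.1 ∧ K ≤ A a.1 a.2 ω}.Finite) ∧
      (∀ k, 1 ≤ k → MeasureTheory.Integrable (B k) (M.P θs)) ∧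
      -- existence of the common limit `Δ_{k,∞}(θ)`, uniform in `θ`
      (∀ᵐ ω ∂(M.P θs), ∀ k : ℕ, 1 ≤ k →
        (∀ x : 𝒳, TendstoUniformly (fun m θ => M.DeltaX k m x θ ω) (fun θ => Δlim k θ ω)
          Filter.atTop) ∧
        TendstoUniformly (fun m θ => M.Delta κ k m θ ω) (fun θ => Δlim k θ ω) Filter.atTop) := by
  have : Nonempty 𝒳 := nonempty_of_isProbabilityMeasure M.μ
  exact Model.uniform_forgetting hq herg hg hlog htail κ fun θ k m => (hκ θ k m).1
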